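/- Let $\mathrm{BH}_1=\mathrm{NP}$ and, for $k>1$, $\mathrm{BH}_k=\{A\setminus B : A\in\mathrm{NP},\ B\in\mathrm{BH}_{k-1}\}$ be the levels of the boolean hierarchy. Let $T$ be a finite binary tree, not necessarily complete, in which every internal node $v$ has exactly two children (left and right) and is labelled by a positive integer $f(v)$. Let $\mathrm{P}^{(T)}$ be the class of languages accepted by a deterministic polynomial-time oracle Turing machine with $T$-like query structure. That is, every internal node $v$ of $T$ carries its own oracle, a set in $\mathrm{BH}_{f(v)}$. The machine starts at the root of $T$. A query made at an internal node $v$ is put to the oracle at $v$, after which the machine is at the left child of $v$ if the answer is "no" and at the right child if it is "yes". At a leaf no further query is made. Both the polynomial time bound and this restriction on the queries hold whatever sets are used as oracles. For $m\ge 0$ let $\mathrm{R}^p_{m\text{-tt}}(\mathrm{NP})$ be the class of languages $A$ for which there are $B\in\mathrm{NP}$ and a polynomial-time computable function that maps every word $x$ to $m$ words $x_1,\dots,x_m$ and a predicate $\alpha$ of $m$ boolean variables such that $$x\in A\iff \alpha(\chi_B(x_1),\dots,\chi_B(x_m)).$$ Define $m(T)=0$ if $T$ is a single leaf. If $T$ has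 a root $r$ with left subtree $L$ and right subtree $R$, put $$m(T)=\begin{cases} f(r)+m(L)+m(R)-1 & \text{if } f(r) \text{ is even and } m(R) \text{ is odd},\\ f(r)+m(L)+m(R) & \text{otherwise.}\end{cases}$$ (In particular $m(T)=f(r)$ if both children of the root are leaves.) Then $$\mathrm{P}^{(T)}=\mathrm{R}^p_{m(T)\text{-tt}}(\mathrm{NP}).$$ -/

import Mathlib

namespace QueryOrder

open Turing StateTransition Computability Polynomial

/-! ### Words, polynomial-time functions, NP, and the boolean hierarchy -/

/-- Words over the binary alphabet. -/
abbrev Word : Type := List Bool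

/-- A pair of words, as an input to a Turing machine: the first word followed by the second one,
the letters of the two words being drawn from two disjoint copies of the binary alphabet. -/
def encodePair : Word × Word → List (Bool ⊕ Bool) :=
  (encodingProd (encodingList Bool) (encodingList Bool)).encode

/-- `NP`: the languages with a polynomial-time verifier and polynomially bounded witnesses. -/
def NP : Set (Language Bool) :=
  {L | ∃ (p : ℕ[X]) (V : Word × Word → Bool),
    Nonempty (TM2ComputableInPolyTime encodePair encodeBool V) ∧
    ∀ x : Word, x ∈ L ↔ ∃ y : Word, y.length ≤ p.eval x.length ∧ V (x, y) = true}

/-- `C₁ ⊖ C₂`: the class of all differences `A - B` with `A ∈ C₁` and `B ∈ C₂`. -/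
def diffClass (C₁ C₂ : Set (Language Bool)) : Set (Language Bool) :=
  {L | ∃ A ∈ C₁, ∃ B ∈ C₂, L = A \ B}

/-- The boolean hierarchy: `BH 1 = NP` and `BH k = NP ⊖ BH (k - 1)` for `k > 1`.
The hierarchy starts at level `1`; the value at `0` is a placeholder that is never used. -/
def BH : ℕ → Set (Language Bool)
  | 0 => ∅
  | 1 => NP
  | k + 2 => diffClass NP (BH (k + 1))

/-! ### Bounded truth-table reductions -/

/-- The truth table of a boolean function of `m` variables: the list of its `2 ^ m` values, the
arguments being in lexicographic order with `false < true`. -/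
def truthTable : (m : ℕ) → ((Fin m → Bool) → Bool) → List Bool
  | 0, α => [α Fin.elim0]
  | m + 1, α =>
      truthTable m (fun v => α (Fin.cons false v)) ++ truthTable m (fun v => α (Fin.cons true v))

/-- The output `(x₁, …, x_m, α)` of a truth-table reduction as a word over `{0, 1, #}`, where `none`
is the separator `#`: the word `x₁ # x₂ # ⋯ # x_m #` followed by the truth table of `α`. -/
def encodeQueries (m : ℕ) (q : (Fin m → Word) × ((Fin m → Bool) → Bool)) : List (Option Bool) :=
  (List.ofFn q.1).flatMap (fun w => w.map some ++ [none]) ++ (truthTable m q.2).map some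

open Classical in
/-- `A ≤ B` by a polynomial-time `m`-truth-table reduction: a polynomial-time function maps every
`x` to `m` strings `x₁, …, x_m` and a predicate `α` of `m` boolean variables such that
`x ∈ A ↔ α(χ_B(x₁), …, χ_B(x_m))`. -/
def TTReducible (m : ℕ) (A B : Language Bool) : Prop :=
  ∃ f : Word → (Fin m → Word) × ((Fin m → Bool) → Bool),
    Nonempty (TM2ComputableInPolyTime (id : Word → List Bool) (encodeQueries m) f) ∧
    ∀ x : Word, x ∈ A ↔ (f x).2 (fun i => decide ((f x).1 i ∈ B)) = true

/-- The closure of the class `C` under polynomial-time `m`-truth-table reductions. -/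
def ttClosure (m : ℕ) (C : Set (Language Bool)) : Set (Language Bool) :=
  {L | ∃ B ∈ C, TTReducible m L B}

/-! ### Oracle machines with tree-like query structure -/

/-- A deterministic oracle Turing machine. The underlying machine has binary input on its input
stack, its output stack serves as the query tape, and three of its labels are the query label
and the two labels at which the computation resumes according to the answer. A halting
computation accepts or rejects according to the internal state in which it halts. -/
structure OracleTM extends TM2ComputableAux Bool Bool where
  /-- the query label -/
  ask : tm.Λ
  /-- the label at which the machine resumes after the answer `yes` -/
  yes : tm.Λ
  /-- the label at which the machine resumes after the answer `no` -/
  no : tm.Λ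
  /-- the accepting internal states -/
  accept : tm.σ → Bool

namespace OracleTM

variable (M : OracleTM)

/-- The initial configuration on input `x`. -/
def init (x : Word) : M.tm.Cfg :=
  initList M.tm (x.map M.inputAlphabet.symm)

/-- The word on the query tape. -/
def query (c : M.tm.Cfg) : Word :=
  (c.stk M.tm.k₁).map M.outputAlphabet

/-- The configuration after a query: the computation resumes at the label `l`, and the query tape
is erased. -/
def resume (c : M.tm.Cfg) (l : M.tm.Λ) : M.tm.Cfg where
  l := some l
  var := c.var
  stk := Function.update c.stk M.tm.k₁ []

open Classical in
/-- One step of the machine whose queries are answered by a binary tree of oracles. The second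
component of a state is the subtree at the current node. A query is put to the oracle at
the current node, and the computation moves on to the left child of this node if the answer is `no`,
and to the right child if it is `yes`. No query can be made at a leaf: the machine is then stuck
without having halted. -/
noncomputable def step :
    M.tm.Cfg × BinaryTree (Language Bool) → Option (M.tm.Cfg × BinaryTree (Language Bool))
  | (c, O) =>
    if c.l = some M.ask then
      match O with
      | .nil => none
      | .node A l r =>
        if M.query c ∈ A then some (M.resume c M.yes, r) else some (M.resume c M.no, l)
    else (M.tm.step c).map fun c' => (c', O)

/-- With the oracle tree `O` and the input `x`, the machine halts within `t` steps, and it accepts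
if `b = true` and rejects if `b = false`. -/
def HaltsWith (O : BinaryTree (Language Bool)) (x : Word) (t : ℕ) (b : Bool) : Prop :=
  ∃ (c : M.tm.Cfg) (O' : BinaryTree (Language Bool)),
    Nonempty (EvalsToInTime M.step (M.init x, O) (some (c, O')) t) ∧
    c.l = none ∧ M.accept c.var = b

end OracleTM

/-- `TreeRel R S T`: the binary trees `S` and `T` have the same shape, and the labels of any two
corresponding internal nodes are related by `R`. -/
inductive TreeRel {α β : Type} (R : α → β → Prop) : BinaryTree α → BinaryTree β → Prop
  | nil : TreeRel R .nil .nil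
  | node {a : α} {b : β} {l r : BinaryTree α} {l' r' : BinaryTree β} :
      R a b → TreeRel R l l' → TreeRel R r r' → TreeRel R (.node a l r) (.node b l' r')

/-- The class `P^(T)` for a binary tree `T` whose internal nodes are labelled by levels of the
boolean hierarchy (leaves are `nil`): the languages accepted by a deterministic polynomial-time
oracle machine whose query structure is `T`. The machine halts in polynomial time, and makes at most
the queries for which `T` provides, whatever the oracles at the internal nodes of `T` are; and it
accepts the language for some choice of oracles such that the oracle at every internal node belongs
to the level of the boolean hierarchy which labels this node. -/
def PTree (T : BinaryTree ℕ+) : Set (Language Bool) :=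
  {L | ∃ (M : OracleTM) (p : ℕ[X]),
    (∀ O : BinaryTree (Language Bool), TreeRel (fun _ _ => True) T O →
      ∀ x : Word, ∃ b : Bool, M.HaltsWith O x (p.eval x.length) b) ∧
    ∃ O : BinaryTree (Language Bool), TreeRel (fun (n : ℕ+) A => A ∈ BH n) T O ∧
      ∀ x : Word, x ∈ L ↔ M.HaltsWith O x (p.eval x.length) true}

/-- The number `m(T)`. A leaf contributes `0`, so `m(T)` is the label of the root if both children
of the root are leaves. -/
def mindChanges : BinaryTree ℕ+ → ℕ
  | .nil => 0
  | .node n l r =>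
    if Even (n : ℕ) ∧ Odd (mindChanges r) then (n : ℕ) + mindChanges l + mindChanges r - 1
    else (n : ℕ) + mindChanges l + mindChanges r

end QueryOrder

namespace QueryOrder

open Turing StateTransition Computability Polynomial

/-! Both classes have one normal form: the languages `L` with `x ∈ L ↔ (b x ^^ (N x).bodd) = true`,
where `b` is decidable in polynomial time, `N x ≤ mindChanges T`, and every condition `j ≤ N x` is
in NP (`NPNumber`).

To reach it, membership is written as a polynomial-time boolean function `α x` of finitely many NP
predicates (`Rep`). Along a chain of assignments starting at `⊥`, the value of `α x` changes some
number of times (`Alt`). Let `N x` be the largest number of changes along a chain that ends at or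
below the true assignment. Such a chain is certified by witnesses for the predicates that hold at
its end, so lower bounds on `N x` are in NP. By maximality no change remains above the end of the
chain, so the parity of `N x` compares `α x` at `⊥` with `α x` at the true assignment
(`Rep.exists_npNumber`).

A function of `m` variables admits at most `m` changes, which settles truth-table reductions. For an
oracle machine, fixing a list of answers leaves a polynomial-time computation of the next query
(`Simulation.fp_final`). By induction on the tree, acceptance at a node is "if `h` then `G` else
`F`", where `h` is the oracle answer, with at most `f(r)` changes, and `F`, `G` belong to the left
and right subtrees. A change of the result needs a change of `h`, `F` or `G`, whence the bound `f(r)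
+ m(L) + m(R)`. If `f(r)` is even and `m(R)` is odd, this sum is not attained: after all `f(r)`
changes `h` is false again, the value is that of `F`, and the number of changes would have the
parity of `m(L)`, which the sum has not (`Rep.ite`, `OracleTM.exists_rep_accepts`).

Conversely, `m` threshold queries determine `N x ≤ m` (`mem_ttClosure_of_npNumber`). For a tree,
`exists_oracles` divides the range of `N` at the root: one interval is left to `L`, one to `R`, and
on another the root oracle itself alternates between the two subtrees, whose contributions stay
fixed there. The machine puts the query `x` at every node (`exists_oracleTM`).

The remaining work is to realise the functions involved by Turing machines with stacks. -/

/-! ### Counting steps -/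

/-- `Steps f n a b`: exactly `n` steps of `f` lead from `a` to `b`. -/
def Steps {Z : Type*} (f : Z → Option Z) : ℕ → Z → Z → Prop
  | 0, a, b => a = b
  | n + 1, a, b => ∃ c, f a = some c ∧ Steps f n c b

theorem Steps.trans {Z : Type*} {f : Z → Option Z} {n k : ℕ} {a b c : Z} (h : Steps f n a b)
    (h' : Steps f k b c) : Steps f (n + k) a c := by
  induction n generalizing a with
  | zero => cases h; simpa using h'
  | succ n ih =>
    obtain ⟨d, hd, h⟩ := h
    rw [Nat.succ_add]
    exact ⟨d, hd, ih h⟩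

theorem Steps.one {Z : Type*} {f : Z → Option Z} {a b : Z} (h : f a = some b) : Steps f 1 a b :=
  ⟨b, h, rfl⟩

theorem iterate_bind_none {Z : Type*} (f : Z → Option Z) (n : ℕ) :
    (flip bind f)^[n] none = none := by
  induction n with
  | zero => rfl
  | succ n ih => rw [Function.iterate_succ_apply]; exact ih

theorem steps_iff {Z : Type*} {f : Z → Option Z} {n : ℕ} {a b : Z} :
    Steps f n a b ↔ (flip bind f)^[n] (some a) = some b := by
  induction n generalizing a with
  | zero => simp [Steps]
  | succ n ih =>
    rw [Function.iterate_succ_apply]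
    have : flip bind f (some a) = f a := rfl
    rw [this]
    cases h : f a with
    | none => rw [iterate_bind_none]; simp [Steps, h]
    | some c => simp [Steps, h, ih]

theorem Steps.unique {Z : Type*} {f : Z → Option Z} {n k : ℕ} {a b c : Z} (h : Steps f n a b)
    (hb : f b = none) (h' : Steps f k a c) (hc : f c = none) : b = c := by
  induction n generalizing a k with
  | zero =>
    cases h
    cases k with
    | zero => exact h'
    | succ k => obtain ⟨d, hd, -⟩ := h'; simp [hb] at hd
  | succ n ih =>
    obtain ⟨d, hd, h⟩ := h
    cases k with
    | zero => cases h'; simp [hc] at hd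
    | succ k =>
      obtain ⟨e, he, h'⟩ := h'
      rw [hd] at he
      cases he
      exact ih h h'

/-- `Reach f a b t`: at most `t` steps of `f` lead from `a` to `b`. -/
def Reach {Z : Type*} (f : Z → Option Z) (a b : Z) (t : ℕ) : Prop :=
  ∃ n ≤ t, Steps f n a b

theorem reach_iff {Z : Type*} {f : Z → Option Z} {a b : Z} {t : ℕ} :
    Reach f a b t ↔ Nonempty (EvalsToInTime f a (some b) t) := by
  constructor
  · rintro ⟨n, hn, h⟩
    exact ⟨⟨⟨n, steps_iff.1 h⟩, hn⟩⟩
  · rintro ⟨⟨⟨n, h⟩, hn⟩⟩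
    exact ⟨n, hn, steps_iff.2 h⟩

theorem Reach.refl {Z : Type*} {f : Z → Option Z} (a : Z) (t : ℕ) : Reach f a a t :=
  ⟨0, Nat.zero_le _, rfl⟩

theorem Reach.trans {Z : Type*} {f : Z → Option Z} {a b c : Z} {t t' : ℕ} (h : Reach f a b t)
    (h' : Reach f b c t') : Reach f a c (t + t') := by
  obtain ⟨n, hn, h⟩ := h
  obtain ⟨k, hk, h'⟩ := h'
  exact ⟨n + k, by omega, h.trans h'⟩

theorem Reach.mono {Z : Type*} {f : Z → Option Z} {a b : Z} {t t' : ℕ} (h : Reach f a b t)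
    (ht : t ≤ t') : Reach f a b t' := by
  obtain ⟨n, hn, h⟩ := h
  exact ⟨n, hn.trans ht, h⟩

theorem Reach.one {Z : Type*} {f : Z → Option Z} {a b : Z} (h : f a = some b) : Reach f a b 1 :=
  ⟨1, le_rfl, .one h⟩

theorem Reach.head {Z : Type*} {f : Z → Option Z} {a b c : Z} {t : ℕ} (h : f a = some b)
    (h' : Reach f b c t) : Reach f a c (t + 1) := by
  rw [add_comm]; exact (Reach.one h).trans h'

/-! ### Polynomial bounds -/

theorem polynomial_eval_mono (p : ℕ[X]) : Monotone fun n => p.eval n := by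
  intro a b hab
  simp only [Polynomial.eval_eq_sum, Polynomial.sum]
  exact Finset.sum_le_sum fun i _ => Nat.mul_le_mul_left _ (Nat.pow_le_pow_left hab i)

/-- `t` is bounded by a polynomial. -/
def PolyBdd (t : ℕ → ℕ) : Prop :=
  ∃ p : ℕ[X], ∀ n, t n ≤ p.eval n

namespace PolyBdd

theorem poly (p : ℕ[X]) : PolyBdd fun n => p.eval n := ⟨p, fun _ => le_rfl⟩

theorem id : PolyBdd fun n => n := ⟨X, fun n => by simp⟩

theorem const (c : ℕ) : PolyBdd fun _ => c := ⟨C c, fun n => by simp⟩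

theorem add {t t' : ℕ → ℕ} (h : PolyBdd t) (h' : PolyBdd t') : PolyBdd fun n => t n + t' n := by
  obtain ⟨p, hp⟩ := h
  obtain ⟨q, hq⟩ := h'
  exact ⟨p + q, fun n => by rw [eval_add]; exact Nat.add_le_add (hp n) (hq n)⟩

theorem mul {t t' : ℕ → ℕ} (h : PolyBdd t) (h' : PolyBdd t') : PolyBdd fun n => t n * t' n := by
  obtain ⟨p, hp⟩ := h
  obtain ⟨q, hq⟩ := h'
  exact ⟨p * q, fun n => by rw [eval_mul]; exact Nat.mul_le_mul (hp n) (hq n)⟩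

theorem comp (p : ℕ[X]) {t : ℕ → ℕ} (h : PolyBdd t) : PolyBdd fun n => p.eval (t n) := by
  obtain ⟨q, hq⟩ := h
  exact ⟨p.comp q, fun n => by rw [eval_comp]; exact polynomial_eval_mono p (hq n)⟩

end PolyBdd

/-! ### Growth of the stacks -/

section Growth

variable {K : Type} [DecidableEq K] {Γ : K → Type} {Λ σ : Type}

/-- The number of `push` instructions in a statement. -/
def pushCount : TM2.Stmt Γ Λ σ → ℕ
  | .push _ _ q => pushCount q + 1
  | .peek _ _ q => pushCount q
  | .pop _ _ q => pushCount q
  | .load _ q => pushCount q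
  | .branch _ q₁ q₂ => pushCount q₁ + pushCount q₂
  | .goto _ => 0
  | .halt => 0

theorem length_stepAux_le (q : TM2.Stmt Γ Λ σ) (v : σ) (S : ∀ k, List (Γ k)) (k : K) :
    ((TM2.stepAux q v S).stk k).length ≤ (S k).length + pushCount q := by
  induction q generalizing v S with
  | push k' f q ih =>
    refine (ih _ _).trans ?_
    by_cases h : k = k'
    · subst h; simp [pushCount]; omega
    · simp [Function.update_of_ne h, pushCount]
  | peek k' f q ih => exact ih _ _
  | pop k' f q ih =>
    refine (ih _ _).trans ?_
    by_cases h : k = k'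
    · subst h; simp [pushCount]
    · simp [Function.update_of_ne h, pushCount]
  | load f q ih => exact ih _ _
  | branch f q₁ q₂ ih₁ ih₂ =>
    simp only [TM2.stepAux, pushCount]
    cases f v
    · exact (ih₂ _ _).trans (by omega)
    · exact (ih₁ _ _).trans (by omega)
  | goto f => simp [TM2.stepAux, pushCount]
  | halt => simp [TM2.stepAux, pushCount]

theorem exists_growth_bound {K Λ σ : Type} {Γ : K → Type} [Finite Λ]
    (m : Λ → TM2.Stmt Γ Λ σ) :
    ∃ C, ∀ l, pushCount (m l) ≤ C := by
  cases nonempty_fintype Λ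
  exact ⟨Finset.univ.sup fun l => pushCount (m l), fun l =>
    Finset.le_sup (f := fun l => pushCount (m l)) (Finset.mem_univ l)⟩

theorem length_step_le {m : Λ → TM2.Stmt Γ Λ σ} {C : ℕ} (hC : ∀ l, pushCount (m l) ≤ C)
    {c d : TM2.Cfg Γ Λ σ} (h : TM2.step m c = some d) (k : K) :
    (d.stk k).length ≤ (c.stk k).length + C := by
  obtain ⟨l, v, S⟩ := c
  cases l with
  | none => simp [TM2.step] at h
  | some l =>
    simp only [TM2.step, Option.some.injEq] at h
    subst h
    exact (length_stepAux_le _ _ _ _).trans (Nat.add_le_add_left (hC l) _)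

/-- Polynomial time gives polynomially long stacks. This bounds the cost of clearing them and of
running a second machine on an output. -/
theorem length_steps_le {m : Λ → TM2.Stmt Γ Λ σ} {C : ℕ} (hC : ∀ l, pushCount (m l) ≤ C)
    {n : ℕ} {c d : TM2.Cfg Γ Λ σ} (h : Steps (TM2.step m) n c d) (k : K) :
    (d.stk k).length ≤ (c.stk k).length + n * C := by
  induction n generalizing c with
  | zero => cases h; simp
  | succ n ih =>
    obtain ⟨e, he, h⟩ := h
    have := ih h
    have := length_step_le hC he k
    rw [Nat.succ_mul]; omega

end Growth

/-! ### Machines as components of larger machines -/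

section Lift

variable {K K' : Type} [DecidableEq K] [DecidableEq K'] {Γ' : K' → Type} {Λ Λ' σ σ' : Type}

/-- The statement of a component, as a statement of a larger machine, in which the component has
the stacks `e k`, a part of the internal state that is read by `get` and written by `set`, and the
labels `lab l`. Instead of halting, the larger machine executes `fin`. -/
def liftStmt (e : K → K') (get : σ' → σ) (set : σ → σ' → σ') (lab : Λ → Λ')
    (fin : TM2.Stmt Γ' Λ' σ') : TM2.Stmt (fun k => Γ' (e k)) Λ σ → TM2.Stmt Γ' Λ' σ'
  | .push k f q => .push (e k) (fun s => f (get s)) (liftStmt e get set lab fin q)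
  | .peek k f q => .peek (e k) (fun s o => set (f (get s) o) s) (liftStmt e get set lab fin q)
  | .pop k f q => .pop (e k) (fun s o => set (f (get s) o) s) (liftStmt e get set lab fin q)
  | .load f q => .load (fun s => set (f (get s)) s) (liftStmt e get set lab fin q)
  | .branch f q₁ q₂ =>
    .branch (fun s => f (get s)) (liftStmt e get set lab fin q₁) (liftStmt e get set lab fin q₂)
  | .goto f => .goto fun s => lab (f (get s))
  | .halt => fin

/-- The laws of a part of the internal state. -/
structure IsLens (get : σ' → σ) (set : σ → σ' → σ') : Prop where
  get_set : ∀ v s, get (set v s) = v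
  set_set : ∀ v w s, set v (set w s) = set v s
  set_get : ∀ s, set (get s) s = s

/-- The component's own state `v` and stacks `R` are separate arguments tied to the large machine by
`hv` and `hR`, so that the induction can pass through updates. The lens laws collapse successive
writes of the component's state into one. -/
theorem stepAux_liftStmt {e : K → K'} (he : Function.Injective e) {get : σ' → σ}
    {set : σ → σ' → σ'} (hl : IsLens get set) (lab : Λ → Λ') (fin : TM2.Stmt Γ' Λ' σ')
    (q : TM2.Stmt (fun k => Γ' (e k)) Λ σ) (s : σ') (S : ∀ k, List (Γ' k))
    (v : σ) (hv : get s = v) (R : ∀ k, List (Γ' (e k))) (hR : ∀ k, S (e k) = R k) :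
    ∃ S' : ∀ k, List (Γ' k),
      (∀ k, S' (e k) = (TM2.stepAux q v R).stk k) ∧
      (∀ k, k ∉ Set.range e → S' k = S k) ∧
      TM2.stepAux (liftStmt e get set lab fin q) s S =
        match (TM2.stepAux q v R).l with
        | some l => ⟨some (lab l), set (TM2.stepAux q v R).var s, S'⟩
        | none => TM2.stepAux fin (set (TM2.stepAux q v R).var s) S' := by
  induction q generalizing s S v R with
  | push k f q ih =>
    obtain ⟨S', h₁, h₂, h₃⟩ := ih s (Function.update S (e k) (f (get s) :: S (e k))) v hv
      (Function.update R k (f v :: R k)) (by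
        intro k'
        by_cases h : k' = k
        · subst h; simp [hv, hR]
        · rw [Function.update_of_ne h, Function.update_of_ne (he.ne h), hR])
    refine ⟨S', h₁, fun k' hk' => ?_, h₃⟩
    rw [h₂ k' hk', Function.update_of_ne]
    rintro rfl; exact hk' ⟨_, rfl⟩
  | peek k f q ih =>
    obtain ⟨S', h₁, h₂, h₃⟩ := ih (set (f (get s) (S (e k)).head?) s) S
      (f v (R k).head?) (by rw [hl.get_set, hv, hR]) R hR
    refine ⟨S', h₁, h₂, ?_⟩
    simp only [hl.set_set] at h₃
    exact h₃
  | pop k f q ih =>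
    obtain ⟨S', h₁, h₂, h₃⟩ := ih (set (f (get s) (S (e k)).head?) s)
      (Function.update S (e k) (S (e k)).tail)
      (f v (R k).head?) (by rw [hl.get_set, hv, hR])
      (Function.update R k (R k).tail) (by
        intro k'
        by_cases h : k' = k
        · subst h; simp [hR]
        · rw [Function.update_of_ne h, Function.update_of_ne (he.ne h), hR])
    refine ⟨S', h₁, fun k' hk' => ?_, ?_⟩
    · rw [h₂ k' hk', Function.update_of_ne]
      rintro rfl; exact hk' ⟨_, rfl⟩
    · simp only [hl.set_set] at h₃
      exact h₃
  | load f q ih =>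
    obtain ⟨S', h₁, h₂, h₃⟩ := ih (set (f (get s)) s) S (f v) (by rw [hl.get_set, hv]) R hR
    refine ⟨S', h₁, h₂, ?_⟩
    simp only [hl.set_set] at h₃
    exact h₃
  | branch f q₁ q₂ ih₁ ih₂ =>
    simp only [TM2.stepAux, liftStmt, hv]
    cases f v
    · exact ih₂ s S v hv R hR
    · exact ih₁ s S v hv R hR
  | goto f =>
    subst hv
    exact ⟨S, hR, fun _ _ => rfl, by simp [TM2.stepAux, liftStmt, hl.set_get]⟩
  | halt =>
    subst hv
    exact ⟨S, hR, fun _ _ => rfl, by simp [TM2.stepAux, liftStmt, hl.set_get]⟩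

/-- A run of a component until it halts, inside a larger machine. -/
theorem steps_lift {e : K → K'} (he : Function.Injective e) {get : σ' → σ}
    {set : σ → σ' → σ'} (hl : IsLens get set) {lab : Λ → Λ'} {ret : Λ'}
    {m : Λ → TM2.Stmt (fun k => Γ' (e k)) Λ σ} {Z : Type*} {st : Z → Option Z}
    {emb : TM2.Cfg Γ' Λ' σ' → Z}
    (hst : ∀ l s S, st (emb ⟨some (lab l), s, S⟩) =
      some (emb (TM2.stepAux (liftStmt e get set lab (.goto fun _ => ret) (m l)) s S)))
    {n : ℕ} {l : Λ} {v : σ} {R : ∀ k, List (Γ' (e k))} {d : TM2.Cfg (fun k => Γ' (e k)) Λ σ}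
    (h : Steps (TM2.step m) n ⟨some l, v, R⟩ d) (hd : d.l = none)
    {s : σ'} {S : ∀ k, List (Γ' k)} (hv : get s = v) (hR : ∀ k, S (e k) = R k) :
    ∃ (w : σ) (S' : ∀ k, List (Γ' k)),
      Steps st n (emb ⟨some (lab l), s, S⟩) (emb ⟨some ret, set w s, S'⟩) ∧
      (∀ k, S' (e k) = d.stk k) ∧ ∀ k, k ∉ Set.range e → S' k = S k := by
  induction n generalizing l v R s S with
  | zero => cases h; simp at hd
  | succ n ih =>
    obtain ⟨c, hc, h⟩ := h
    simp only [TM2.step, Option.some.injEq] at hc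
    obtain ⟨S', h₁, h₂, h₃⟩ :=
      stepAux_liftStmt he hl lab (.goto fun _ => ret) (m l) s S v hv R hR
    rw [hc] at h₁ h₃
    obtain ⟨cl, cv, cS⟩ := c
    cases cl with
    | none =>
      have : n = 0 ∧ d = ⟨none, cv, cS⟩ := by
        cases n with
        | zero => exact ⟨rfl, h.symm⟩
        | succ n => obtain ⟨_, h, _⟩ := h; simp [TM2.step] at h
      obtain ⟨rfl, rfl⟩ := this
      refine ⟨cv, S', .one ?_, h₁, h₂⟩
      rw [hst, h₃]; rfl
    | some l' =>
      obtain ⟨w, S'', i₁, i₂, i₃⟩ := ih (l := l') h (s := set cv s) (S := S')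
        (hl.get_set _ _) h₁
      refine ⟨w, S'', ?_, i₂, fun k hk => (i₃ k hk).trans (h₂ k hk)⟩
      rw [hl.set_set] at i₁
      refine ⟨_, ?_, i₁⟩
      rw [hst, h₃]

end Lift

/-! ### Functions computable in polynomial time by machines that need not clean up -/

theorem initList_eq (tm : FinTM2) (s : List (tm.Γ tm.k₀)) :
    initList tm s = ⟨some tm.main, tm.initialState, Function.update (fun _ => []) tm.k₀ s⟩ := by
  unfold initList
  congr 1
  funext k
  by_cases h : k = tm.k₀
  · subst h; simp
  · simp [h]

theorem haltList_eq (tm : FinTM2) (s : List (tm.Γ tm.k₁)) :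
    haltList tm s = ⟨none, tm.initialState, Function.update (fun _ => []) tm.k₁ s⟩ := by
  unfold haltList
  congr 1
  funext k
  by_cases h : k = tm.k₁
  · subst h; simp
  · simp [h]

/-- On input `s` the machine halts within `t` steps with `r` on its output stack. -/
def Computes {A B : Type} (M : TM2ComputableAux A B) (s : List A) (r : List B) (t : ℕ) : Prop :=
  ∃ c : TM2.Cfg M.tm.Γ M.tm.Λ M.tm.σ,
    Reach (TM2.step M.tm.m) ⟨some M.tm.main, M.tm.initialState,
      Function.update (fun _ => []) M.tm.k₀ (s.map M.inputAlphabet.symm)⟩ c t ∧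
    c.l = none ∧ (c.stk M.tm.k₁).map M.outputAlphabet = r

/-- The function `g` is computable in polynomial time from the encoding `ea` of its argument. -/
def FP {α A B : Type} (ea : α → List A) (g : α → List B) : Prop :=
  ∃ (M : TM2ComputableAux A B) (t : ℕ → ℕ), PolyBdd t ∧
    ∀ a, Computes M (ea a) (g a) (t (ea a).length)

theorem FP.of_computable {α β A B : Type} {ea : α → List A} {eb : β → List B} {f : α → β}
    (h : TM2ComputableInPolyTime ea eb f) : FP ea fun a => eb (f a) := by
  refine ⟨h.toTM2ComputableAux, fun n => h.time.eval n, .poly _, fun a => ?_⟩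
  have := reach_iff.2 ⟨h.outputsFun a⟩
  rw [initList_eq, haltList_eq] at this
  refine ⟨_, this, rfl, ?_⟩
  simp

/-! ### Clearing the stacks after a computation. -/

namespace Cleanup

variable {K : Type} [DecidableEq K] {Γ : K → Type} {Λ σ : Type}

/-- Pop one symbol from every stack in a list of stacks, recording whether there was one. -/
def popAll (q : TM2.Stmt Γ Λ (σ × Bool)) : List K → TM2.Stmt Γ Λ (σ × Bool)
  | [] => q
  | k :: ks => .pop k (fun s o => (s.1, s.2 || o.isSome)) (popAll q ks)

/-- Without repetitions in `ks` every stack is popped once, so the recorded bit refers to the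
contents before the statement. -/
theorem stepAux_popAll (q : TM2.Stmt Γ Λ (σ × Bool)) (ks : List K) (hk : ks.Nodup) (v : σ)
    (b : Bool) (S : ∀ k, List (Γ k)) :
    TM2.stepAux (popAll q ks) (v, b) S =
      TM2.stepAux q (v, b || ks.any fun k => !(S k).isEmpty)
        (fun k => if k ∈ ks then (S k).tail else S k) := by
  induction ks generalizing b S with
  | nil => simp [popAll]
  | cons k ks ih =>
    rw [List.nodup_cons] at hk
    simp only [popAll, TM2.stepAux]
    rw [ih hk.2]
    congr 1
    · congr 1
      rw [List.any_cons, Bool.or_assoc]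
      congr 1
      congr 1
      · cases S k <;> rfl
      · rw [Bool.eq_iff_iff]
        simp only [List.any_eq_true]
        refine exists_congr fun k' => and_congr_right fun hk' => ?_
        rw [Function.update_of_ne]
        rintro rfl; exact hk.1 hk'
    · funext k'
      by_cases h : k' = k
      · subst h; simp [hk.1]
      · simp [h]

variable (m : Λ → TM2.Stmt Γ Λ σ) (ks : List K) (v₀ : σ)

/-- The program that first executes the program `m`, and then clears the stacks `ks` and resets the
internal state. -/
def prog : Option Λ → TM2.Stmt Γ (Option Λ) (σ × Bool)
  | some l => liftStmt (Γ' := Γ) id Prod.fst (fun v s => (v, s.2)) some (.goto fun _ => none) (m l)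
  | none => popAll (.branch Prod.snd (.load (fun s => (s.1, false)) (.goto fun _ => none))
      (.load (fun _ => (v₀, false)) .halt)) ks

/-- Each round shortens all stacks at once, so the time depends on the highest stack only; the extra
step is the round that finds everything empty. -/
theorem reach_clear (hk : ks.Nodup) (n : ℕ) (v : σ) (S : ∀ k, List (Γ k))
    (hS : ∀ k ∈ ks, (S k).length ≤ n) :
    Reach (TM2.step (prog m ks v₀)) ⟨some none, (v, false), S⟩
      ⟨none, (v₀, false), fun k => if k ∈ ks then [] else S k⟩ (n + 1) := by
  induction n generalizing S with
  | zero =>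
    refine .one ?_
    simp only [TM2.step, prog]
    rw [stepAux_popAll _ _ hk]
    have : (ks.any fun k => !(S k).isEmpty) = false := by
      simp only [List.any_eq_false, Bool.not_eq_true', Bool.not_eq_false]
      intro k hk
      simpa using hS k hk
    simp only [this, TM2.stepAux, Bool.or_false, cond_false]
    congr 2
    funext k
    split_ifs with h
    · have := hS k h
      have : S k = [] := by simpa using this
      simp [this]
    · rfl
  | succ n ih =>
    cases hany : ks.any fun k => !(S k).isEmpty with
    | false =>
      refine (ih S ?_).mono (by omega)
      intro k hk
      simp only [List.any_eq_false] at hany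
      have := hany k hk
      have : S k = [] := by simpa using this
      simp [this]
    | true =>
      have key : TM2.step (prog m ks v₀) ⟨some none, (v, false), S⟩ =
          some ⟨some none, (v, false), fun k => if k ∈ ks then (S k).tail else S k⟩ := by
        simp only [TM2.step, prog]
        rw [stepAux_popAll _ _ hk]
        simp only [hany, TM2.stepAux, Bool.or_true, cond_true]
      refine .head key ?_
      have := ih (fun k => if k ∈ ks then (S k).tail else S k) (by
        intro k hk
        have := hS k hk
        simp [hk]; omega)
      convert this using 2
      funext k
      split_ifs <;> rfl

end Cleanup

theorem isLens_fst {σ ρ : Type} : IsLens (Prod.fst : σ × ρ → σ) (fun v s => (v, s.2)) :=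
  ⟨fun _ _ => rfl, fun _ _ _ => rfl, fun _ => rfl⟩

/-- `TM2ComputableInPolyTime` demands that a halting machine be back in its initial state with all
stacks but the output empty. `FP` does not, and the clearing phase bridges the gap: its time is
bounded by the stack heights, hence by a polynomial. -/
theorem FP.computable {α β A B : Type} {ea : α → List A} {eb : β → List B} {f : α → β}
    (h : FP ea fun a => eb (f a)) : Nonempty (TM2ComputableInPolyTime ea eb f) := by
  obtain ⟨⟨tm, iA, oA⟩, t, ⟨p, hp⟩, h⟩ := h
  let := tm.kFin
  let := tm.ΛFin
  let := tm.σFin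
  let := tm.Γk₀Fin
  obtain ⟨C₀, hC⟩ := exists_growth_bound tm.m
  let ks := ((Finset.univ : Finset tm.K).erase tm.k₁).toList
  have hks : ks.Nodup := Finset.nodup_toList _
  have mem_ks : ∀ k, k ∈ ks ↔ k ≠ tm.k₁ := fun k => by simp [ks]
  let tm' : FinTM2 :=
    { K := tm.K
      k₀ := tm.k₀
      k₁ := tm.k₁
      Γ := tm.Γ
      Λ := Option tm.Λ
      main := some tm.main
      σ := tm.σ × Bool
      initialState := (tm.initialState, false)
      m := Cleanup.prog tm.m ks tm.initialState }
  refine ⟨{ tm := tm', inputAlphabet := iA, outputAlphabet := oA,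
            time := p + (X + p * C C₀ + 1), outputsFun := fun a => ?_ }⟩
  refine Classical.choice (reach_iff.1 ?_)
  rw [initList_eq, haltList_eq]
  obtain ⟨d, ⟨n, hn, hd⟩, hdl, hdo⟩ := h a
  obtain ⟨w, S', h₁, h₂, -⟩ := steps_lift (K := tm.K) (K' := tm.K) (Γ' := tm.Γ) (e := id)
    Function.injective_id isLens_fst (lab := some) (ret := none) (m := tm.m)
    (st := TM2.step tm'.m) (emb := id) (fun l s S => rfl) hd hdl
    (s := (tm.initialState, false)) (S := Function.update (fun _ => []) tm.k₀ ((ea a).map iA.symm))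
    rfl (fun _ => rfl)
  have hlen : ∀ k ∈ ks, (S' k).length ≤ (ea a).length + n * C₀ := by
    intro k _
    have h₂ : S' k = d.stk k := h₂ k
    rw [h₂]
    refine (length_steps_le hC hd k).trans (Nat.add_le_add_right ?_ _)
    by_cases hk : k = tm.k₀
    · subst hk; simp
    · simp [Function.update_of_ne hk]
  have h₃ := Cleanup.reach_clear tm.m ks tm.initialState hks _ w S' hlen
  have h₄ := Reach.trans ⟨n, le_rfl, h₁⟩ h₃
  have hn' := hn.trans (hp _)
  refine Reach.mono ?_ (t := n + ((ea a).length + n * C₀ + 1)) ?_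
  · have hfin : Function.update (fun _ => []) tm'.k₁ (List.map oA.invFun (eb (f a))) =
        fun k => if k ∈ ks then [] else S' k := by
      funext k
      by_cases hk : k = tm.k₁
      · subst hk
        have h₂ : S' tm.k₁ = d.stk tm.k₁ := h₂ _
        have : ¬ (tm.k₁ ∈ ks) := by simp [mem_ks]
        rw [if_neg this, h₂]
        simp only [← hdo]
        simp [tm']
      · rw [if_pos ((mem_ks k).2 hk), Function.update_of_ne hk]
    rw [hfin]
    exact h₄
  · simp only [eval_add, eval_mul, eval_X, eval_C, eval_one]
    have := Nat.mul_le_mul_right C₀ hn'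
    omega

theorem length_startStk_le {K : Type} [DecidableEq K] (Γ : K → Type) (k₀ : K) (s : List (Γ k₀))
    (k : K) : (Function.update (fun _ => [] : ∀ k, List (Γ k)) k₀ s k).length ≤ s.length := by
  by_cases h : k = k₀
  · subst h; simp
  · simp [Function.update_of_ne h]

theorem startStk_comp {K K' : Type} [DecidableEq K] [DecidableEq K'] {Γ' : K' → Type} {e : K → K'}
    (he : Function.Injective e) (k₀ : K) (s : List (Γ' (e k₀))) (k : K) :
    Function.update (fun _ => [] : ∀ k, List (Γ' k)) (e k₀) s (e k) =
      Function.update (fun _ => [] : ∀ k, List (Γ' (e k))) k₀ s k := by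
  by_cases h : k = k₀
  · subst h; simp
  · rw [Function.update_of_ne h, Function.update_of_ne (he.ne h)]

/-- The length of the output is polynomially bounded. -/
theorem FP.length_le {α A B : Type} {ea : α → List A} {g : α → List B} (h : FP ea g) :
    ∃ t, PolyBdd t ∧ ∀ a, (g a).length ≤ t (ea a).length := by
  obtain ⟨⟨tm, iA, oA⟩, t, ht, h⟩ := h
  let := tm.ΛFin
  obtain ⟨C₀, hC⟩ := exists_growth_bound tm.m
  refine ⟨fun n => n + t n * C₀, .add .id (.mul ht (.const _)), fun a => ?_⟩
  obtain ⟨d, ⟨n, hn, hd⟩, -, hdo⟩ := h a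
  rw [← hdo, List.length_map]
  refine (length_steps_le hC hd _).trans (Nat.add_le_add ?_ (Nat.mul_le_mul_right _ hn))
  exact (length_startStk_le _ _ _ _).trans (by simp)

/-! ### Loops that move the contents of stacks -/

section Loops

variable {K : Type} {Γ : K → Type} {Λ σ : Type}

/-- A loop that empties the stack `a`, pushing the symbols `g k x` on the stack `k` for every symbol
`x` it reads. -/
theorem reach_drain {Z : Type*} {st : Z → Option Z} {emb : TM2.Cfg Γ Λ σ → Z} {l ret : Λ} {a : K}
    (g : ∀ k, Γ a → List (Γ k)) (P : σ → Prop)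
    (hcons : ∀ s S x r, P s → S a = x :: r → ∃ s' S', P s' ∧ S' a = r ∧
      (∀ k, k ≠ a → S' k = g k x ++ S k) ∧
      st (emb ⟨some l, s, S⟩) = some (emb ⟨some l, s', S'⟩))
    (hnil : ∀ s S, P s → S a = [] → ∃ s', P s' ∧
      st (emb ⟨some l, s, S⟩) = some (emb ⟨some ret, s', S⟩))
    (s : σ) (S : ∀ k, List (Γ k)) (hs : P s) :
    ∃ s' S', P s' ∧ S' a = [] ∧ (∀ k, k ≠ a → S' k = (S a).reverse.flatMap (g k) ++ S k) ∧
      Reach st (emb ⟨some l, s, S⟩) (emb ⟨some ret, s', S'⟩) ((S a).length + 1) := by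
  generalize hL : S a = L
  induction L generalizing s S with
  | nil =>
    obtain ⟨s', hs', h⟩ := hnil s S hs hL
    exact ⟨s', S, hs', hL, fun k _ => by simp, .one h⟩
  | cons x r ih =>
    obtain ⟨s', S', hs', ha, hk, h⟩ := hcons s S x r hs hL
    obtain ⟨s'', S'', i₁, i₂, i₃, i₄⟩ := ih s' S' hs' ha
    refine ⟨s'', S'', i₁, i₂, fun k hka => ?_, .head h i₄⟩
    rw [i₃ k hka, hk k hka]
    simp

variable [DecidableEq K]

/-- Move the contents of the stack `a` to the stack `b`, thereby reversing it. -/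
def moveStmt {X : Type} [Inhabited X] (a b : K) (wr : Option X → σ → σ) (rd : σ → Option X)
    (i : Γ a → X) (f : X → Γ b) (l ret : Λ) : TM2.Stmt Γ Λ σ :=
  .pop a (fun s o => wr (o.map i) s) (.branch (fun s => (rd s).isSome)
    (.push b (fun s => f ((rd s).getD default)) (.goto fun _ => l)) (.goto fun _ => ret))

/-- `wr` and `rd` are a one-symbol buffer in the internal state, and `P` is what the buffer leaves
untouched. Abstract `st` and `emb` allow the same loop to run beside a tree of oracles. -/
theorem reach_move {X : Type} [Inhabited X] {Z : Type*} {st : Z → Option Z}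
    {emb : TM2.Cfg Γ Λ σ → Z} {l ret : Λ} {a b : K}
    (hab : a ≠ b) {wr : Option X → σ → σ} {rd : σ → Option X} {i : Γ a → X} {f : X → Γ b}
    (hst : ∀ s S, st (emb ⟨some l, s, S⟩) =
      some (emb (TM2.stepAux (moveStmt a b wr rd i f l ret) s S)))
    (hrd : ∀ o s, rd (wr o s) = o) (P : σ → Prop) (hP : ∀ o s, P s → P (wr o s))
    (s : σ) (S : ∀ k, List (Γ k)) (hs : P s) {w : List X} (hw : (S a).map i = w) :
    ∃ s' S', P s' ∧ S' a = [] ∧ S' b = w.reverse.map f ++ S b ∧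
      (∀ k, k ≠ a → k ≠ b → S' k = S k) ∧
      Reach st (emb ⟨some l, s, S⟩) (emb ⟨some ret, s', S'⟩) (w.length + 1) := by
  subst hw
  obtain ⟨s', S', h₁, h₂, h₃, h₄⟩ := reach_drain (st := st) (emb := emb) (l := l) (ret := ret)
    (a := a) (Function.update (fun _ _ => []) b fun x => [f (i x)]) P
    (by
      intro s S x r hs hx
      rw [hst]
      simp only [moveStmt, TM2.stepAux, hrd, hx, List.head?_cons, Option.map_some,
        Option.isSome_some, cond_true, Option.getD_some,
        List.tail_cons]
      refine ⟨_, _, hP _ s hs, ?_, ?_, rfl⟩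
      · rw [Function.update_of_ne hab, Function.update_self]
      · intro k hk
        by_cases hkb : k = b
        · subst hkb; simp [Function.update_of_ne hk]
        · simp [Function.update_of_ne hkb, Function.update_of_ne hk])
    (by
      intro s S hs hx
      rw [hst]
      simp only [moveStmt, TM2.stepAux, hrd, hx, List.head?_nil, Option.map_none,
        Option.isSome_none, cond_false,
        List.tail_nil]
      refine ⟨wr none s, hP _ s hs, ?_⟩
      rw [← hx, Function.update_eq_self]) s S hs
  refine ⟨s', S', h₁, h₂, ?_, fun k hka hkb => ?_, by simpa using h₄⟩
  · rw [h₃ b hab.symm, ← List.map_reverse, List.map_map, List.map_eq_flatMap]; simp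
  · rw [h₃ k hka]; simp [Function.update_of_ne hkb]

/-- Move the contents of the stack `a` to the stacks `b` and `c`, thereby reversing it. -/
def copyStmt {X : Type} [Inhabited X] (a b c : K) (wr : Option X → σ → σ) (rd : σ → Option X)
    (i : Γ a → X) (f : X → Γ b) (f' : X → Γ c) (l ret : Λ) : TM2.Stmt Γ Λ σ :=
  .pop a (fun s o => wr (o.map i) s) (.branch (fun s => (rd s).isSome)
    (.push b (fun s => f ((rd s).getD default))
      (.push c (fun s => f' ((rd s).getD default)) (.goto fun _ => l)))
    (.goto fun _ => ret))

theorem reach_copy {X : Type} [Inhabited X] {Z : Type*} {st : Z → Option Z}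
    {emb : TM2.Cfg Γ Λ σ → Z} {l ret : Λ}
    {a b c : K} (hab : a ≠ b) (hac : a ≠ c) (hbc : b ≠ c)
    {wr : Option X → σ → σ} {rd : σ → Option X} {i : Γ a → X} {f : X → Γ b} {f' : X → Γ c}
    (hst : ∀ s S, st (emb ⟨some l, s, S⟩) =
      some (emb (TM2.stepAux (copyStmt a b c wr rd i f f' l ret) s S)))
    (hrd : ∀ o s, rd (wr o s) = o) (P : σ → Prop) (hP : ∀ o s, P s → P (wr o s))
    (s : σ) (S : ∀ k, List (Γ k)) (hs : P s) {w : List X} (hw : (S a).map i = w) :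
    ∃ s' S', P s' ∧ S' a = [] ∧ S' b = w.reverse.map f ++ S b ∧ S' c = w.reverse.map f' ++ S c ∧
      (∀ k, k ≠ a → k ≠ b → k ≠ c → S' k = S k) ∧
      Reach st (emb ⟨some l, s, S⟩) (emb ⟨some ret, s', S'⟩) (w.length + 1) := by
  subst hw
  obtain ⟨s', S', h₁, h₂, h₃, h₄⟩ := reach_drain (st := st) (emb := emb) (l := l) (ret := ret)
    (a := a) (Function.update (Function.update (fun _ _ => []) b fun x => [f (i x)]) c
      fun x => [f' (i x)]) P
    (by
      intro s S x r hs hx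
      rw [hst]
      simp only [copyStmt, TM2.stepAux, hrd, hx, List.head?_cons, Option.map_some,
        Option.isSome_some, cond_true, Option.getD_some,
        List.tail_cons]
      refine ⟨_, _, hP _ s hs, ?_, ?_, rfl⟩
      · rw [Function.update_of_ne hac, Function.update_of_ne hab, Function.update_self]
      · intro k hk
        by_cases hkc : k = c
        · subst hkc; simp [Function.update_of_ne hk, Function.update_of_ne hbc.symm]
        · by_cases hkb : k = b
          · subst hkb; simp [Function.update_of_ne hk, Function.update_of_ne hkc]
          · simp [Function.update_of_ne hkb, Function.update_of_ne hk, Function.update_of_ne hkc])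
    (by
      intro s S hs hx
      rw [hst]
      simp only [copyStmt, TM2.stepAux, hrd, hx, List.head?_nil, Option.map_none,
        Option.isSome_none, cond_false,
        List.tail_nil]
      refine ⟨wr none s, hP _ s hs, ?_⟩
      rw [← hx, Function.update_eq_self]) s S hs
  refine ⟨s', S', h₁, h₂, ?_, ?_, fun k hka hkb hkc => ?_, by simpa using h₄⟩
  · rw [h₃ b hab.symm, ← List.map_reverse, List.map_map, List.map_eq_flatMap]
    simp [Function.update_of_ne hbc]
  · rw [h₃ c hac.symm, ← List.map_reverse, List.map_map, List.map_eq_flatMap]; simp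
  · rw [h₃ k hka]; simp [Function.update_of_ne hkb, Function.update_of_ne hkc]

end Loops

/-! ### Composition -/

namespace Comp

variable {A B C : Type} [Inhabited B] (M : TM2ComputableAux A B) (N : TM2ComputableAux B C)

abbrev Stk : Type := M.tm.K ⊕ N.tm.K ⊕ Unit

def Alph : Stk M N → Type
  | .inl k => M.tm.Γ k
  | .inr (.inl k) => N.tm.Γ k
  | .inr (.inr _) => B

abbrev State : Type := M.tm.σ × N.tm.σ × Option B

abbrev Lab : Type := M.tm.Λ ⊕ N.tm.Λ ⊕ Fin 3

/-- A move reverses a word, so the output of `M` passes through an auxiliary stack on its way to the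
input of `N`. -/
def prog : Lab M N → TM2.Stmt (Alph M N) (Lab M N) (State M N)
  | .inl l => liftStmt (Γ' := Alph M N) Sum.inl Prod.fst (fun v s => (v, s.2)) Sum.inl
      (.goto fun _ => .inr (.inr 0)) (M.tm.m l)
  | .inr (.inl l) => liftStmt (Γ' := Alph M N) (fun k => .inr (.inl k)) (fun s => s.2.1)
      (fun v s => (s.1, v, s.2.2)) (fun l => .inr (.inl l))
      (.goto fun _ => .inr (.inr 2)) (N.tm.m l)
  | .inr (.inr 0) => moveStmt (Γ := Alph M N) (.inl M.tm.k₁) (.inr (.inr ()))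
      (fun o s => (s.1, s.2.1, o)) (fun s => s.2.2) M.outputAlphabet id
      (.inr (.inr 0)) (.inr (.inr 1))
  | .inr (.inr 1) => moveStmt (Γ := Alph M N) (.inr (.inr ())) (.inr (.inl N.tm.k₀))
      (fun o s => (s.1, s.2.1, o)) (fun s => s.2.2) id N.inputAlphabet.symm
      (.inr (.inr 1)) (.inr (.inl N.tm.main))
  | .inr (.inr 2) => .halt

end Comp

theorem isLens_snd {σ τ ρ : Type} :
    IsLens (fun s : τ × σ × ρ => s.2.1) (fun v s => (s.1, v, s.2.2)) :=
  ⟨fun _ _ => rfl, fun _ _ _ => rfl, fun _ => rfl⟩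

open QueryOrder.Comp in
theorem FP.comp {α β A B C : Type} [Inhabited B] [Finite B] {ea : α → List A} {eb : β → List B}
    {f : α → β} {g : β → List C} (hg : FP eb g) (hf : FP ea fun a => eb (f a)) :
    FP ea fun a => g (f a) := by
  obtain ⟨u, hu, hlen⟩ := hf.length_le
  obtain ⟨M, t, ht, hM⟩ := hf
  obtain ⟨N, t', ⟨q, hq⟩, hN⟩ := hg
  let := M.tm.kFin
  let := M.tm.ΛFin
  let := M.tm.σFin
  let := M.tm.Γk₀Fin
  let := N.tm.kFin
  let := N.tm.ΛFin
  let := N.tm.σFin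
  let := Fintype.ofFinite B
  let tm : FinTM2 :=
    { K := Stk M N
      k₀ := .inl M.tm.k₀
      k₁ := .inr (.inl N.tm.k₁)
      Γ := Alph M N
      Λ := Lab M N
      main := .inl M.tm.main
      σ := State M N
      initialState := (M.tm.initialState, N.tm.initialState, none)
      Γk₀Fin := M.tm.Γk₀Fin
      m := prog M N }
  refine ⟨⟨tm, M.inputAlphabet, N.outputAlphabet⟩,
    fun n => t n + (u n + 1) + (u n + 1) + q.eval (u n) + 1,
    .add (.add (.add (.add ht (.add hu (.const _))) (.add hu (.const _))) (.comp _ hu)) (.const _),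
    fun a => ?_⟩
  obtain ⟨d, ⟨n, hn, hd⟩, hdl, hdo⟩ := hM a
  obtain ⟨d', ⟨n', hn', hd'⟩, hdl', hdo'⟩ := hN (f a)
  have hS₀ : ∀ k, Function.update (fun _ => [] : ∀ k, List (Alph M N k)) (Sum.inl M.tm.k₀)
      ((ea a).map M.inputAlphabet.symm) (.inl k) =
      Function.update (fun _ => [] : ∀ k, List (M.tm.Γ k)) M.tm.k₀
        ((ea a).map M.inputAlphabet.symm) k :=
    startStk_comp (Γ' := Alph M N) Sum.inl_injective _ _
  obtain ⟨w, S₁, h₁, h₁', h₁''⟩ := steps_lift (Γ' := Alph M N) Sum.inl_injective isLens_fst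
    (lab := Sum.inl) (ret := .inr (.inr 0)) (m := M.tm.m) (st := TM2.step (prog M N)) (emb := id)
    (fun l s S => rfl) hd hdl (s := (M.tm.initialState, N.tm.initialState, none))
    (S := Function.update (fun _ => []) (Sum.inl M.tm.k₀) ((ea a).map M.inputAlphabet.symm))
    rfl hS₀
  have h₁e : ∀ k, S₁ (.inr k) = [] := fun k => by
    rw [h₁'' _ (by simp), Function.update_of_ne (by simp)]
  obtain ⟨s₂, S₂, p₂, h₂a, h₂b, h₂c, h₂⟩ := reach_move (Γ := Alph M N) (st := TM2.step (prog M N))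
    (emb := id) (l := .inr (.inr 0)) (ret := .inr (.inr 1)) (a := .inl M.tm.k₁)
    (b := .inr (.inr ()))
    (wr := fun o s => (s.1, s.2.1, o)) (rd := fun s => s.2.2) (i := M.outputAlphabet) (f := id)
    (by simp) (fun s S => rfl) (fun o s => rfl)
    (fun s => s.2.1 = N.tm.initialState) (fun o s h => h)
    (w, N.tm.initialState, none) S₁ rfl ((congrArg _ (h₁' _)).trans hdo)
  have e₂ : S₂ (.inr (.inr ())) = (eb (f a)).reverse := by
    rw [h₂b, h₁e, List.append_nil]; exact List.map_id _
  obtain ⟨s₃, S₃, p₃, h₃a, h₃b, h₃c, h₃⟩ := reach_move (Γ := Alph M N) (st := TM2.step (prog M N))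
    (emb := id) (l := .inr (.inr 1)) (ret := .inr (.inl N.tm.main)) (a := .inr (.inr ()))
    (b := .inr (.inl N.tm.k₀)) (wr := fun o s => (s.1, s.2.1, o)) (rd := fun s => s.2.2)
    (i := id) (f := N.inputAlphabet.symm) (by simp) (fun s S => rfl) (fun o s => rfl)
    (fun s => s.2.1 = N.tm.initialState) (fun o s h => h) s₂ S₂ p₂ ((List.map_id _).trans e₂)
  have e₃ : ∀ k, S₃ (.inr (.inl k)) =
      Function.update (fun _ => []) N.tm.k₀ ((eb (f a)).map N.inputAlphabet.symm) k := by
    intro k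
    by_cases hk : k = N.tm.k₀
    · subst hk
      rw [h₃b, h₂c _ (by simp) (by simp), h₁e, List.reverse_reverse]
      exact (List.append_nil _).trans
        (Function.update_self (β := fun k => List (N.tm.Γ k)) _ _ _).symm
    · rw [h₃c _ (by simp) (by simpa using hk), h₂c _ (by simp) (by simp), h₁e,
        Function.update_of_ne hk]
      rfl
  obtain ⟨w', S₄, h₄, h₄', -⟩ := steps_lift (Γ' := Alph M N) (e := fun k => .inr (.inl k))
    (fun a b h => by simpa using h) isLens_snd
    (lab := fun l => .inr (.inl l)) (ret := .inr (.inr 2)) (m := N.tm.m)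
    (st := TM2.step (prog M N)) (emb := id)
    (fun l s S => rfl) hd' hdl' p₃ e₃
  have h₅ : TM2.step (prog M N) ⟨some (.inr (.inr 2)), (s₃.1, w', s₃.2.2), S₄⟩ =
      some ⟨none, (s₃.1, w', s₃.2.2), S₄⟩ := rfl
  refine ⟨_, (((Reach.trans ⟨n, le_rfl, h₁⟩ h₂).trans h₃).trans
    (Reach.trans ⟨n', le_rfl, h₄⟩ (.one h₅))).mono ?_, rfl, ?_⟩
  · have l₁ := hlen a
    have l₂ := List.length_reverse (as := eb (f a))
    have l₃ : n' ≤ q.eval (u (ea a).length) :=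
      (hn'.trans (hq _)).trans (polynomial_eval_mono q (hlen a))
    beta_reduce at *
    omega
  · exact (congrArg (List.map N.outputAlphabet) (h₄' N.tm.k₁)).trans hdo'

/-! ### Concatenation of outputs -/

namespace Append

variable {A B : Type} [Inhabited A] [Inhabited B] (M N : TM2ComputableAux A B)

abbrev Stk : Type := M.tm.K ⊕ N.tm.K ⊕ Bool ⊕ Bool

def Alph : Stk M N → Type
  | .inl k => M.tm.Γ k
  | .inr (.inl k) => N.tm.Γ k
  | .inr (.inr (.inl _)) => A
  | .inr (.inr (.inr _)) => B

abbrev State : Type := M.tm.σ × N.tm.σ × Option A × Option B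

abbrev Lab : Type := M.tm.Λ ⊕ N.tm.Λ ⊕ Fin 7

/-- The input is reversed once and then copied to both machines, which restores its order. The
output of `N` goes to the common stack before that of `M`, because later words land on top, that is,
in front. -/
def prog : Lab M N → TM2.Stmt (Alph M N) (Lab M N) (State M N)
  | .inl l => liftStmt (Γ' := Alph M N) Sum.inl Prod.fst (fun v s => (v, s.2)) Sum.inl
      (.goto fun _ => .inr (.inl N.tm.main)) (M.tm.m l)
  | .inr (.inl l) => liftStmt (Γ' := Alph M N) (fun k => .inr (.inl k)) (fun s => s.2.1)
      (fun v s => (s.1, v, s.2.2)) (fun l => .inr (.inl l))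
      (.goto fun _ => .inr (.inr 2)) (N.tm.m l)
  | .inr (.inr 0) => moveStmt (Γ := Alph M N) (.inr (.inr (.inl false))) (.inr (.inr (.inl true)))
      (fun o s => (s.1, s.2.1, o, s.2.2.2)) (fun s => s.2.2.1) id id
      (.inr (.inr 0)) (.inr (.inr 1))
  | .inr (.inr 1) => copyStmt (Γ := Alph M N) (.inr (.inr (.inl true))) (.inl M.tm.k₀)
      (.inr (.inl N.tm.k₀))
      (fun o s => (s.1, s.2.1, o, s.2.2.2)) (fun s => s.2.2.1) id M.inputAlphabet.symm
      N.inputAlphabet.symm (.inr (.inr 1)) (.inl M.tm.main)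
  | .inr (.inr 2) => moveStmt (Γ := Alph M N) (.inr (.inl N.tm.k₁)) (.inr (.inr (.inr false)))
      (fun o s => (s.1, s.2.1, s.2.2.1, o)) (fun s => s.2.2.2) N.outputAlphabet id
      (.inr (.inr 2)) (.inr (.inr 3))
  | .inr (.inr 3) => moveStmt (Γ := Alph M N) (.inr (.inr (.inr false))) (.inr (.inr (.inr true)))
      (fun o s => (s.1, s.2.1, s.2.2.1, o)) (fun s => s.2.2.2) id id
      (.inr (.inr 3)) (.inr (.inr 4))
  | .inr (.inr 4) => moveStmt (Γ := Alph M N) (.inl M.tm.k₁) (.inr (.inr (.inr false)))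
      (fun o s => (s.1, s.2.1, s.2.2.1, o)) (fun s => s.2.2.2) M.outputAlphabet id
      (.inr (.inr 4)) (.inr (.inr 5))
  | .inr (.inr 5) => moveStmt (Γ := Alph M N) (.inr (.inr (.inr false))) (.inr (.inr (.inr true)))
      (fun o s => (s.1, s.2.1, s.2.2.1, o)) (fun s => s.2.2.2) id id
      (.inr (.inr 5)) (.inr (.inr 6))
  | .inr (.inr 6) => .halt

end Append

open QueryOrder.Append in
theorem FP.append {α A B : Type} [Inhabited A] [Inhabited B] [Finite A] [Finite B]
    {ea : α → List A} {f g : α → List B} (hf : FP ea f) (hg : FP ea g) :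
    FP ea fun a => f a ++ g a := by
  obtain ⟨u, hu, hlen⟩ := hf.length_le
  obtain ⟨u', hu', hlen'⟩ := hg.length_le
  obtain ⟨M, t, ht, hM⟩ := hf
  obtain ⟨N, t', ht', hN⟩ := hg
  let := M.tm.kFin
  let := M.tm.ΛFin
  let := M.tm.σFin
  let := N.tm.kFin
  let := N.tm.ΛFin
  let := N.tm.σFin
  let := Fintype.ofFinite A
  let := Fintype.ofFinite B
  let tm : FinTM2 :=
    { K := Stk M N
      k₀ := .inr (.inr (.inl false))
      k₁ := .inr (.inr (.inr true))
      Γ := Alph M N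
      Λ := Lab M N
      main := .inr (.inr 0)
      σ := State M N
      initialState := (M.tm.initialState, N.tm.initialState, none, none)
      Γk₀Fin := (inferInstance : Fintype A)
      m := prog M N }
  refine ⟨⟨tm, Equiv.refl A, Equiv.refl B⟩,
    fun n => (n + 1) + (n + 1) + (t n + t' n) + (u' n + 1) + (u' n + 1) + (u n + 1) + (u n + 1) + 1,
    ?_, fun a => ?_⟩
  · have c := PolyBdd.const 1
    exact .add (.add (.add (.add (.add (.add (.add (.add .id c) (.add .id c)) (.add ht ht'))
      (.add hu' c)) (.add hu' c)) (.add hu c)) (.add hu c)) c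
  obtain ⟨d, ⟨n, hn, hd⟩, hdl, hdo⟩ := hM a
  obtain ⟨d', ⟨n', hn', hd'⟩, hdl', hdo'⟩ := hN a
  let S₀ : ∀ k, List (Alph M N k) := Function.update (fun _ => []) (.inr (.inr (.inl false)))
    ((ea a).map (Equiv.refl A).symm)
  have hS₀ : ∀ k, k ≠ .inr (.inr (.inl false)) → S₀ k = [] := fun k hk =>
    Function.update_of_ne (β := fun k => List (Alph M N k)) hk _ _
  obtain ⟨s₁, S₁, p₁, a₁, b₁, c₁, r₁⟩ := reach_move (Γ := Alph M N) (st := TM2.step (prog M N))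
    (emb := id) (l := .inr (.inr 0)) (ret := .inr (.inr 1)) (a := .inr (.inr (.inl false)))
    (b := .inr (.inr (.inl true)))
    (wr := fun o s => (s.1, s.2.1, o, s.2.2.2)) (rd := fun s => s.2.2.1) (i := id) (f := id)
    (by simp) (fun s S => rfl) (fun o s => rfl)
    (fun s => s.1 = M.tm.initialState ∧ s.2.1 = N.tm.initialState) (fun o s h => h)
    (M.tm.initialState, N.tm.initialState, none, none) S₀ ⟨rfl, rfl⟩ (w := ea a)
    ((List.map_id _).trans ((Function.update_self (β := fun k => List (Alph M N k)) _ _ _).trans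
      (List.map_id _)))
  have e₁ : ∀ k, k ≠ .inr (.inr (.inl true)) → S₁ k = [] := fun k hk => by
    by_cases h : k = .inr (.inr (.inl false))
    · rw [h, a₁]
    · rw [c₁ k h hk, hS₀ k h]
  obtain ⟨s₂, S₂, p₂, a₂, b₂, c₂, d₂, r₂⟩ := reach_copy (Γ := Alph M N)
    (st := TM2.step (prog M N)) (emb := id) (l := .inr (.inr 1)) (ret := .inl M.tm.main)
    (a := .inr (.inr (.inl true))) (b := .inl M.tm.k₀) (c := .inr (.inl N.tm.k₀))
    (wr := fun o s => (s.1, s.2.1, o, s.2.2.2)) (rd := fun s => s.2.2.1) (i := id)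
    (f := M.inputAlphabet.symm) (f' := N.inputAlphabet.symm)
    (by simp) (by simp) (by simp) (fun s S => rfl) (fun o s => rfl)
    (fun s => s.1 = M.tm.initialState ∧ s.2.1 = N.tm.initialState) (fun o s h => h)
    s₁ S₁ p₁ (w := (ea a).reverse) (by
      refine (List.map_id _).trans (b₁.trans ?_)
      rw [hS₀ _ (by simp)]; exact (List.append_nil _).trans (List.map_id _))
  have e₂ : ∀ k, S₂ (.inl k) =
      Function.update (fun _ => []) M.tm.k₀ ((ea a).map M.inputAlphabet.symm) k := by
    intro k
    by_cases hk : k = M.tm.k₀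
    · subst hk
      rw [b₂, e₁ _ (by simp), List.reverse_reverse]
      exact (List.append_nil _).trans
        (Function.update_self (β := fun k => List (M.tm.Γ k)) _ _ _).symm
    · rw [d₂ _ (by simp) (by simpa using hk) (by simp), e₁ _ (by simp), Function.update_of_ne hk]
      rfl
  have e₂' : ∀ k, S₂ (.inr (.inl k)) =
      Function.update (fun _ => []) N.tm.k₀ ((ea a).map N.inputAlphabet.symm) k := by
    intro k
    by_cases hk : k = N.tm.k₀
    · subst hk
      rw [c₂, e₁ _ (by simp), List.reverse_reverse]
      exact (List.append_nil _).trans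
        (Function.update_self (β := fun k => List (N.tm.Γ k)) _ _ _).symm
    · rw [d₂ _ (by simp) (by simp) (by simpa using hk), e₁ _ (by simp), Function.update_of_ne hk]
      rfl
  have e₂'' : ∀ b, S₂ (.inr (.inr (.inr b))) = [] := fun b => by
    rw [d₂ _ (by simp) (by simp) (by simp), e₁ _ (by simp)]
  obtain ⟨w, S₃, r₃, a₃, b₃⟩ := steps_lift (Γ' := Alph M N) Sum.inl_injective isLens_fst
    (lab := Sum.inl) (ret := .inr (.inl N.tm.main)) (m := M.tm.m) (st := TM2.step (prog M N))
    (emb := id) (fun l s S => rfl) hd hdl p₂.1 e₂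
  obtain ⟨w', S₄, r₄, a₄, b₄⟩ := steps_lift (Γ' := Alph M N) (e := fun k => .inr (.inl k))
    (fun a b h => by simpa using h) isLens_snd
    (lab := fun l => .inr (.inl l)) (ret := .inr (.inr 2)) (m := N.tm.m)
    (st := TM2.step (prog M N)) (emb := id) (s := (w, s₂.2)) (S := S₃)
    (fun l s S => rfl) hd' hdl' p₂.2 (fun k => (b₃ _ (by simp)).trans (e₂' k))
  have e₄ : ∀ b, S₄ (.inr (.inr (.inr b))) = [] := fun b => by
    rw [b₄ _ (by simp), b₃ _ (by simp), e₂'']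
  obtain ⟨s₅, S₅, -, a₅, b₅, c₅, r₅⟩ := reach_move (Γ := Alph M N) (st := TM2.step (prog M N))
    (emb := id) (l := .inr (.inr 2)) (ret := .inr (.inr 3)) (a := .inr (.inl N.tm.k₁))
    (b := .inr (.inr (.inr false)))
    (wr := fun o s => (s.1, s.2.1, s.2.2.1, o)) (rd := fun s => s.2.2.2) (i := N.outputAlphabet)
    (f := id) (by simp) (fun s S => rfl) (fun o s => rfl) (fun _ => True) (fun o s h => h)
    (w, w', s₂.2.2) S₄ trivial ((congrArg _ (a₄ _)).trans hdo')
  obtain ⟨s₆, S₆, -, a₆, b₆, c₆, r₆⟩ := reach_move (Γ := Alph M N) (st := TM2.step (prog M N))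
    (emb := id) (l := .inr (.inr 3)) (ret := .inr (.inr 4)) (a := .inr (.inr (.inr false)))
    (b := .inr (.inr (.inr true)))
    (wr := fun o s => (s.1, s.2.1, s.2.2.1, o)) (rd := fun s => s.2.2.2) (i := id)
    (f := id) (by simp) (fun s S => rfl) (fun o s => rfl) (fun _ => True) (fun o s h => h)
    s₅ S₅ trivial (w := (g a).reverse) (by
      refine (List.map_id _).trans (b₅.trans ?_)
      rw [e₄]; exact (List.append_nil _).trans (List.map_id _))
  have e₆ : S₆ (.inr (.inr (.inr true))) = g a := by
    rw [b₆, c₅ _ (by simp) (by simp), e₄, List.reverse_reverse]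
    exact (List.append_nil _).trans (List.map_id _)
  obtain ⟨s₇, S₇, -, a₇, b₇, c₇, r₇⟩ := reach_move (Γ := Alph M N) (st := TM2.step (prog M N))
    (emb := id) (l := .inr (.inr 4)) (ret := .inr (.inr 5)) (a := .inl M.tm.k₁)
    (b := .inr (.inr (.inr false)))
    (wr := fun o s => (s.1, s.2.1, s.2.2.1, o)) (rd := fun s => s.2.2.2) (i := M.outputAlphabet)
    (f := id) (by simp) (fun s S => rfl) (fun o s => rfl) (fun _ => True) (fun o s h => h)
    s₆ S₆ trivial (w := f a) (by
      rw [c₆ _ (by simp) (by simp), c₅ _ (by simp) (by simp), b₄ _ (by simp), a₃]; exact hdo)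
  obtain ⟨s₈, S₈, -, a₈, b₈, c₈, r₈⟩ := reach_move (Γ := Alph M N) (st := TM2.step (prog M N))
    (emb := id) (l := .inr (.inr 5)) (ret := .inr (.inr 6)) (a := .inr (.inr (.inr false)))
    (b := .inr (.inr (.inr true)))
    (wr := fun o s => (s.1, s.2.1, s.2.2.1, o)) (rd := fun s => s.2.2.2) (i := id)
    (f := id) (by simp) (fun s S => rfl) (fun o s => rfl) (fun _ => True) (fun o s h => h)
    s₇ S₇ trivial (w := (f a).reverse) (by
      refine (List.map_id _).trans (b₇.trans ?_)
      rw [a₆]; exact (List.append_nil _).trans (List.map_id _))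
  have e₈ : S₈ (.inr (.inr (.inr true))) = f a ++ g a := by
    rw [b₈, c₇ _ (by simp) (by simp), e₆, List.reverse_reverse]
    exact congrArg (· ++ g a) (List.map_id _)
  have r₉ : TM2.step (prog M N) ⟨some (.inr (.inr 6)), s₈, S₈⟩ = some ⟨none, s₈, S₈⟩ := rfl
  refine ⟨⟨none, s₈, S₈⟩,
    ((((((((r₁.trans r₂).trans (Reach.trans ⟨n, le_rfl, r₃⟩ ⟨n', le_rfl, r₄⟩)).trans
    r₅).trans r₆).trans r₇).trans r₈).trans (.one r₉)).mono ?_), rfl, ?_⟩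
  · have := hlen a
    have := hlen' a
    simp only [List.length_reverse] at *
    omega
  · exact (List.map_id _).trans e₈

/-! ### Finite transducers -/

/-- The output of a finite transducer, which reads a word from left to right and writes at most one
symbol for every symbol it reads, and at most one symbol at the end. -/
def transduce {Q A B : Type} (δ : Q → A → Q) (o : Q → A → Option B) (e : Q → Option B) :
    Q → List A → List B
  | q, [] => (e q).toList
  | q, a :: w => (o q a).toList ++ transduce δ o e (δ q a) w

theorem length_transduce_le {Q A B : Type} (δ : Q → A → Q) (o : Q → A → Option B)
    (e : Q → Option B) (q : Q) (w : List A) : (transduce δ o e q w).length ≤ w.length + 1 := by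
  induction w generalizing q with
  | nil => cases h : e q <;> simp [transduce, h]
  | cons a w ih =>
    have := ih (δ q a)
    cases h : o q a <;> simp [transduce, h] <;> omega

namespace Transducer

variable {Q A B : Type} [Inhabited B] (δ : Q → A → Q) (o : Q → A → Option B) (e : Q → Option B)
  {Γ : Option Bool → Type} (i : Γ none → A) (j : B → Γ (some false)) (j' : Γ (some false) → B)
  (i' : B → Γ (some true))

def Alph (A B : Type) : Option Bool → Type
  | none => A
  | some _ => B

abbrev State (Q A B : Type) : Type := Q × Option A × Option B

def prog : Fin 3 → TM2.Stmt Γ (Fin 3) (State Q A B)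
  | 0 => .pop none (fun s x => (s.1, x.map i, s.2.2)) <| .branch (fun s => s.2.1.isSome)
      (.branch (fun s => (s.2.1.bind (o s.1)).isSome)
        (.push (some false) (fun s => j ((s.2.1.bind (o s.1)).getD default)) <|
          .load (fun s => ((s.2.1.map (δ s.1)).getD s.1, none, none)) <| .goto fun _ => 0)
        (.load (fun s => ((s.2.1.map (δ s.1)).getD s.1, none, none)) <| .goto fun _ => 0))
      (.branch (fun s => (e s.1).isSome)
        (.push (some false) (fun s => j ((e s.1).getD default)) <| .goto fun _ => 1)
        (.goto fun _ => 1))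
  | 1 => moveStmt (some false) (some true) (fun x s => (s.1, s.2.1, x)) (fun s => s.2.2) j' i' 1 2
  | 2 => .halt

theorem reach_read (w : List A) (q : Q) (x : Option A) (y : Option B)
    (S : ∀ k, List (Γ k))
    (hS : (S none).map i = w) :
    ∃ s' S', S' (some false) = (transduce δ o e q w).reverse.map j ++ S (some false) ∧
      S' (some true) = S (some true) ∧
      Reach (TM2.step (prog δ o e i j j' i')) ⟨some 0, (q, x, y), S⟩ ⟨some 1, s', S'⟩
        (w.length + 1) := by
  induction w generalizing q x y S with
  | nil =>
    rw [List.map_eq_nil_iff] at hS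
    cases he : e q with
    | none =>
      refine ⟨(q, none, y), Function.update S none [], by simp [transduce, he], by simp, .one ?_⟩
      simp [TM2.step, prog, TM2.stepAux, hS, he]
    | some b =>
      refine ⟨(q, none, y), Function.update (Function.update S none []) (some false)
        (j b :: S (some false)), by simp [transduce, he], by simp, .one ?_⟩
      simp [TM2.step, prog, TM2.stepAux, hS, he]
  | cons a w ih =>
    obtain ⟨a, w, hS', rfl, rfl⟩ := List.map_eq_cons_iff.1 hS
    cases ho : o q (i a) with
    | none =>
      obtain ⟨s', S', h₁, h₂, h₃⟩ := ih (δ q (i a)) none none (Function.update S none w) (by simp)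
      refine ⟨s', S', ?_, ?_, .head ?_ h₃⟩
      · rw [h₁]; simp [transduce, ho]
      · rw [h₂]; simp
      · simp only [TM2.step, prog, TM2.stepAux, hS', List.head?_cons, Option.map_some,
            Option.isSome_some, cond_true,
          List.tail_cons, Option.bind_some, ho, Option.isSome_none, cond_false, Option.map_some,
          Option.getD_some]
    | some b =>
      obtain ⟨s', S', h₁, h₂, h₃⟩ := ih (δ q (i a)) none none
        (Function.update (Function.update S none w) (some false) (j b :: S (some false))) (by simp)
      refine ⟨s', S', ?_, ?_, .head ?_ h₃⟩
      · rw [h₁]; simp [transduce, ho]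
      · rw [h₂]; simp
      · simp only [TM2.step, prog, TM2.stepAux, hS', List.head?_cons, Option.map_some,
            Option.isSome_some, cond_true,
          List.tail_cons, Option.bind_some, ho, Option.map_some, Option.getD_some]
        simp

end Transducer

open QueryOrder.Transducer in
theorem fp_transduce {Q A B : Type} [Finite Q] [Finite A] [Finite B] [Inhabited B]
    (δ : Q → A → Q) (o : Q → A → Option B) (e : Q → Option B) (q : Q) :
    FP (id : List A → List A) (transduce δ o e q) := by
  let := Fintype.ofFinite A
  let := Fintype.ofFinite B
  let := Fintype.ofFinite Q
  let tm : FinTM2 :=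
    { K := Option Bool
      k₀ := none
      k₁ := some true
      Γ := Alph A B
      Λ := Fin 3
      main := 0
      σ := State Q A B
      initialState := (q, none, none)
      Γk₀Fin := (inferInstance : Fintype A)
      m := prog (Γ := Alph A B) δ o e id id id id }
  refine ⟨⟨tm, Equiv.refl A, Equiv.refl B⟩, fun n => (n + 1) + (n + 1 + 1) + 1,
    .add (.add (.add .id (.const _)) (.add (.add .id (.const _)) (.const _))) (.const _),
    fun w => ?_⟩
  let S₀ : ∀ k, List (Alph A B k) := Function.update (fun _ => []) none
    ((id w).map (Equiv.refl A).symm)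
  obtain ⟨s₁, S₁, a₁, b₁, r₁⟩ := reach_read (Γ := Alph A B) δ o e id id id id w q none none S₀
    ((List.map_id _).trans ((Function.update_self (β := fun k => List (Alph A B k)) _ _ _).trans
      (List.map_id _)))
  have h₀ : ∀ b, S₀ (some b) = [] := fun b =>
    Function.update_of_ne (β := fun k => List (Alph A B k)) (by simp) _ _
  obtain ⟨s₂, S₂, -, -, b₂, -, r₂⟩ := reach_move (Γ := Alph A B)
    (st := TM2.step (prog (Γ := Alph A B) δ o e id id id id))
    (emb := id) (l := 1) (ret := 2) (a := some false) (b := some true)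
    (wr := fun x s => (s.1, s.2.1, x)) (rd := fun s => s.2.2) (i := id) (f := id)
    (by simp) (fun s S => rfl) (fun o s => rfl) (fun _ => True) (fun o s h => h) s₁ S₁ trivial
    (w := (transduce δ o e q w).reverse) (by
      refine (List.map_id _).trans (a₁.trans ?_)
      rw [h₀]; exact (List.append_nil _).trans (List.map_id _))
  have r₃ : TM2.step (prog (Γ := Alph A B) δ o e id id id id) ⟨some 2, s₂, S₂⟩ =
      some ⟨none, s₂, S₂⟩ := rfl
  refine ⟨⟨none, s₂, S₂⟩, ((r₁.trans r₂).trans (.one r₃)).mono ?_, rfl, ?_⟩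
  · have := length_transduce_le δ o e q w
    simp only [List.length_reverse, id]
    omega
  · refine (List.map_id _).trans (b₂.trans ?_)
    rw [b₁, h₀, List.reverse_reverse]
    exact (List.append_nil _).trans (List.map_id _)

theorem FP.transduce {α Q A B : Type} [Finite Q] [Finite A] [Inhabited A] [Finite B] [Inhabited B]
    {ea : α → List A} {X : Type} [Finite X] [Inhabited X] {f : α → List X} (hf : FP ea f)
    (δ : Q → X → Q) (o : Q → X → Option B) (e : Q → Option B) (q : Q) :
    FP ea fun a => transduce δ o e q (f a) :=
  FP.comp (eb := (id : List X → List X)) (fp_transduce δ o e q) hf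

/-! ### Multiplication and comparison of numbers in unary -/

/-- A pair of numbers in unary. -/
def encodeUnaryPair (n : ℕ × ℕ) : List Bool :=
  List.replicate n.1 true ++ List.replicate n.2 false

namespace Unary

inductive Stk
  | inp | fst | snd | tmp | out
  deriving DecidableEq

instance : Fintype Stk :=
  ⟨{.inp, .fst, .snd, .tmp, .out}, fun k => by cases k <;> simp⟩

/-- The stacks with the given contents, all symbols being `true`. -/
def contents (w : List Bool) (a b c d : ℕ) : Stk → List Bool
  | .inp => w
  | .fst => List.replicate a true
  | .snd => List.replicate b true
  | .tmp => List.replicate c true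
  | .out => List.replicate d true

/-- Every symbol of `fst` triggers one pass that adds `snd` to `out` while saving it on `tmp` (label
`2`), and one pass that restores it (label `3`). -/
def mulProg : Fin 4 → TM2.Stmt (fun _ : Stk => Bool) (Fin 4) (Option Bool)
  | 0 => .pop .inp (fun _ x => x) <| .branch Option.isSome
      (.branch (fun s => s.getD true) (.push .fst (fun _ => true) (.goto fun _ => 0))
        (.push .snd (fun _ => true) (.goto fun _ => 0)))
      (.goto fun _ => 1)
  | 1 => .pop .fst (fun _ x => x) <| .branch Option.isSome (.goto fun _ => 2) .halt
  | 2 => .pop .snd (fun _ x => x) <| .branch Option.isSome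
      (.push .tmp (fun _ => true) (.push .out (fun _ => true) (.goto fun _ => 2)))
      (.goto fun _ => 3)
  | 3 => .pop .tmp (fun _ x => x) <| .branch Option.isSome
      (.push .snd (fun _ => true) (.goto fun _ => 3)) (.goto fun _ => 1)

theorem reach_read (w : List Bool) (a b : ℕ) (s : Option Bool) :
    ∃ s', Reach (TM2.step mulProg) ⟨some 0, s, contents w a b 0 0⟩
      ⟨some 1, s', contents [] (a + w.count true) (b + w.count false) 0 0⟩ (w.length + 1) := by
  induction w generalizing a b s with
  | nil =>
    refine ⟨none, .one ?_⟩
    refine congrArg some (congrArg (TM2.Cfg.mk _ _) ?_)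
    funext k; cases k <;> simp [contents]
  | cons x w ih =>
    cases x with
    | true =>
      obtain ⟨s', h⟩ := ih (a + 1) b (some true)
      refine ⟨s', .head ?_ (by simpa [add_comm, add_left_comm, add_assoc] using h)⟩
      refine congrArg some (congrArg (TM2.Cfg.mk _ _) ?_)
      funext k; cases k <;> simp [contents, List.replicate_succ]
    | false =>
      obtain ⟨s', h⟩ := ih a (b + 1) (some false)
      refine ⟨s', .head ?_ (by simpa [add_comm, add_left_comm, add_assoc] using h)⟩
      refine congrArg some (congrArg (TM2.Cfg.mk _ _) ?_)
      funext k; cases k <;> simp [contents, List.replicate_succ]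

theorem reach_add (a b c d : ℕ) (s : Option Bool) :
    ∃ s', Reach (TM2.step mulProg) ⟨some 2, s, contents [] a b c d⟩
      ⟨some 3, s', contents [] a 0 (c + b) (d + b)⟩ (b + 1) := by
  induction b generalizing c d s with
  | zero =>
    refine ⟨none, .one ?_⟩
    refine congrArg some (congrArg (TM2.Cfg.mk _ _) ?_)
    funext k; cases k <;> simp [contents]
  | succ b ih =>
    obtain ⟨s', h⟩ := ih (c + 1) (d + 1) (some true)
    refine ⟨s', .head ?_ (by simpa [add_comm, add_left_comm, add_assoc] using h)⟩
    refine congrArg some (congrArg (TM2.Cfg.mk _ _) ?_)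
    funext k; cases k <;> simp [contents, List.replicate_succ]

theorem reach_restore (a b c d : ℕ) (s : Option Bool) :
    ∃ s', Reach (TM2.step mulProg) ⟨some 3, s, contents [] a b c d⟩
      ⟨some 1, s', contents [] a (b + c) 0 d⟩ (c + 1) := by
  induction c generalizing b s with
  | zero =>
    refine ⟨none, .one ?_⟩
    refine congrArg some (congrArg (TM2.Cfg.mk _ _) ?_)
    funext k; cases k <;> simp [contents]
  | succ c ih =>
    obtain ⟨s', h⟩ := ih (b + 1) (some true)
    refine ⟨s', .head ?_ (by simpa [add_comm, add_left_comm, add_assoc] using h)⟩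
    refine congrArg some (congrArg (TM2.Cfg.mk _ _) ?_)
    funext k; cases k <;> simp [contents, List.replicate_succ]

theorem reach_mul (a b d : ℕ) (s : Option Bool) :
    ∃ s', Reach (TM2.step mulProg) ⟨some 1, s, contents [] a b 0 d⟩
      ⟨none, s', contents [] 0 b 0 (d + a * b)⟩ (a * (2 * b + 3) + 1) := by
  induction a generalizing d s with
  | zero =>
    refine ⟨none, (Reach.one ?_).mono (by omega)⟩
    refine congrArg some (congrArg (TM2.Cfg.mk _ _) ?_)
    funext k; cases k <;> simp [contents]
  | succ a ih =>
    obtain ⟨s₁, h₁⟩ := reach_add a b 0 d (some true)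
    obtain ⟨s₂, h₂⟩ := reach_restore a 0 (0 + b) (d + b) s₁
    obtain ⟨s₃, h₃⟩ := ih (d + b) s₂
    rw [zero_add, zero_add] at h₂
    rw [zero_add] at h₁
    refine ⟨s₃, ?_⟩
    have h₀ : TM2.step mulProg ⟨some 1, s, contents [] (a + 1) b 0 d⟩ =
        some ⟨some 2, some true, contents [] a b 0 d⟩ := by
      refine congrArg some (congrArg (TM2.Cfg.mk _ _) ?_)
      funext k; cases k <;> simp [contents]
    have := ((Reach.one h₀).trans (h₁.trans h₂)).trans h₃
    rw [show d + b + a * b = d + (a + 1) * b by ring] at this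
    exact this.mono (by ring_nf; omega)

theorem fp_mul : FP encodeUnaryPair fun n => List.replicate (n.1 * n.2) true := by
  let tm : FinTM2 :=
    { K := Stk
      k₀ := .inp
      k₁ := .out
      Γ := fun _ => Bool
      Λ := Fin 4
      main := 0
      σ := Option Bool
      initialState := none
      Γk₀Fin := inferInstance
      m := mulProg }
  refine ⟨⟨tm, Equiv.refl Bool, Equiv.refl Bool⟩, fun n => (n + 1) + (n * (2 * n + 3) + 1),
    .add (.add .id (.const _)) (.add (.mul .id (.add (.mul (.const _) .id) (.const _)))
      (.const _)), fun n => ?_⟩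
  obtain ⟨s₁, h₁⟩ := reach_read (encodeUnaryPair n) 0 0 none
  obtain ⟨s₂, h₂⟩ := reach_mul n.1 n.2 0 s₁
  have e₁ : 0 + (encodeUnaryPair n).count true = n.1 := by
    simp [encodeUnaryPair, List.count_replicate]
  have e₂ : 0 + (encodeUnaryPair n).count false = n.2 := by
    simp [encodeUnaryPair, List.count_replicate]
  rw [e₁, e₂] at h₁
  refine ⟨⟨none, s₂, contents [] 0 n.2 0 (0 + n.1 * n.2)⟩, ?_, rfl, ?_⟩
  · have : Function.update (fun _ => [] : Stk → List Bool) .inp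
        ((encodeUnaryPair n).map (Equiv.refl Bool).symm) =
          contents (encodeUnaryPair n) 0 0 0 0 := by
      funext k; cases k <;> simp [contents]
    have h := h₁.trans h₂
    rw [← this] at h
    refine h.mono ?_
    have l : (encodeUnaryPair n).length = n.1 + n.2 := by simp [encodeUnaryPair]
    simp only [l]
    gcongr <;> omega
  · refine (List.map_id _).trans ?_
    simp [contents, tm]

/-- The stack `fst` is a counter, filled by the first block and lowered by each symbol of the
second; the answer is negative when it cannot be lowered. -/
def leProg : Fin 2 → TM2.Stmt (fun _ : Stk => Bool) (Fin 2) (Option Bool)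
  | 0 => .pop .inp (fun _ x => x) <| .branch Option.isSome
      (.branch (fun s => s.getD true) (.push .fst (fun _ => true) (.goto fun _ => 0))
        (.pop .fst (fun _ x => x) <| .branch Option.isSome (.goto fun _ => 0)
          (.push .out (fun _ => false) .halt)))
      (.push .out (fun _ => true) .halt)
  | 1 => .halt

theorem reach_push (w : List Bool) (n a : ℕ) (s : Option Bool) :
    ∃ s', Reach (TM2.step leProg) ⟨some 0, s, contents (List.replicate n true ++ w) a 0 0 0⟩
      ⟨some 0, s', contents w (a + n) 0 0 0⟩ n := by
  induction n generalizing a s with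
  | zero => exact ⟨s, .refl _ _⟩
  | succ n ih =>
    obtain ⟨s', h⟩ := ih (a + 1) (some true)
    refine ⟨s', .head ?_ (by simpa [add_comm, add_left_comm, add_assoc] using h)⟩
    refine congrArg some (congrArg (TM2.Cfg.mk _ _) ?_)
    funext k; cases k <;> simp [contents, List.replicate_succ]

theorem reach_pop (n a : ℕ) (s : Option Bool) :
    ∃ c : TM2.Cfg (fun _ : Stk => Bool) (Fin 2) (Option Bool), Reach (TM2.step leProg)
      ⟨some 0, s, contents (List.replicate n false) a 0 0 0⟩ c (n + 1) ∧ c.l = none ∧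
      c.stk .out = [decide (n ≤ a)] := by
  induction n generalizing a s with
  | zero =>
    refine ⟨_, .one rfl, ?_, ?_⟩
    · simp [leProg, TM2.stepAux, contents]
    · simp [leProg, TM2.stepAux, contents]
  | succ n ih =>
    cases a with
    | zero =>
      refine ⟨_, Reach.mono (t := 1) (.one rfl) (by omega), ?_, ?_⟩
      · simp [leProg, TM2.stepAux, contents, List.replicate_succ]
      · simp [leProg, TM2.stepAux, contents, List.replicate_succ]
    | succ a =>
      obtain ⟨c, h, hc, ho⟩ := ih a (some true)
      refine ⟨c, .head ?_ h, hc, by simpa using ho⟩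
      refine congrArg some (congrArg (TM2.Cfg.mk _ _) ?_)
      funext k; cases k <;> simp [contents, List.replicate_succ]

theorem fp_le : FP encodeUnaryPair fun n => encodeBool (decide (n.2 ≤ n.1)) := by
  let tm : FinTM2 :=
    { K := Stk
      k₀ := .inp
      k₁ := .out
      Γ := fun _ => Bool
      Λ := Fin 2
      main := 0
      σ := Option Bool
      initialState := none
      Γk₀Fin := inferInstance
      m := leProg }
  refine ⟨⟨tm, Equiv.refl Bool, Equiv.refl Bool⟩, fun n => n + 1, .add .id (.const _),
    fun n => ?_⟩
  obtain ⟨s₁, h₁⟩ := reach_push (List.replicate n.2 false) n.1 0 none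
  obtain ⟨c, h₂, hc, ho⟩ := reach_pop n.2 (0 + n.1) s₁
  refine ⟨c, ?_, hc, ?_⟩
  · have : Function.update (fun _ => [] : Stk → List Bool) .inp
        ((encodeUnaryPair n).map (Equiv.refl Bool).symm) =
          contents (encodeUnaryPair n) 0 0 0 0 := by
      funext k; cases k <;> simp [contents]
    have h := h₁.trans h₂
    rw [← encodeUnaryPair, ← this] at h
    refine h.mono ?_
    simp [encodeUnaryPair]; omega
  · refine (List.map_id _).trans (ho.trans ?_)
    rw [zero_add]; rfl

end Unary

/-! ### Closure properties of polynomial-time functions -/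

theorem FP.encoding {α A : Type} [Finite A] (ea : α → List A) : FP ea ea := by
  let := Fintype.ofFinite A
  exact FP.of_computable (idComputableInPolyTime ea)

/-- A predicate that is decidable in polynomial time. -/
def Dec {α A : Type} (ea : α → List A) (g : α → Bool) : Prop := FP ea fun a => encodeBool (g a)

theorem Dec.comp {α β A B : Type} [Inhabited B] [Finite B] {ea : α → List A} {eb : β → List B}
    {g : β → Bool} {f : α → β} (hg : Dec eb g) (hf : FP ea fun a => eb (f a)) :
    Dec ea fun a => g (f a) :=
  FP.comp (f := f) (g := fun b => encodeBool (g b)) hg hf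

section Closure

variable {α A B X : Type} [Finite A] [Inhabited A] [Finite B] [Inhabited B] [Finite X] [Inhabited X]
  {ea : α → List A}

theorem FP.filterMap {f : α → List X} (hf : FP ea f) (h : X → Option B) :
    FP ea fun a => (f a).filterMap h := by
  have key : ∀ w : List X, QueryOrder.transduce (fun (_ : Unit) _ => ()) (fun _ x => h x)
      (fun _ => none) () w = w.filterMap h := by
    intro w
    induction w with
    | nil => rfl
    | cons x w ih => cases hx : h x <;> simp [QueryOrder.transduce, ih, hx]
  simpa only [key] using hf.transduce (fun (_ : Unit) _ => ()) (fun _ x => h x) (fun _ => none) ()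

theorem FP.map {f : α → List X} (hf : FP ea f) (h : X → B) : FP ea fun a => (f a).map h := by
  simpa using hf.filterMap fun x => some (h x)

theorem FP.tail {f : α → List X} (hf : FP ea f) : FP ea fun a => (f a).tail := by
  have key : ∀ w : List X, QueryOrder.transduce (fun (_ : Bool) _ => true)
      (fun q x => if q then some x else none) (fun _ => none) true w = w := by
    intro w
    induction w with
    | nil => rfl
    | cons x w ih => simp [QueryOrder.transduce, ih]
  have key' : ∀ w : List X, QueryOrder.transduce (fun (_ : Bool) _ => true)
      (fun q x => if q then some x else none) (fun _ => none) false w = w.tail := by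
    intro w
    cases w with
    | nil => rfl
    | cons x w => simp [QueryOrder.transduce, key]
  simpa only [key'] using hf.transduce (fun (_ : Bool) _ => true)
      (fun q x => if q then some x else none) (fun _ => none) false

theorem FP.const (w : List B) : FP ea fun _ => w := by
  induction w with
  | nil =>
    have key : ∀ w : List A, QueryOrder.transduce (fun (_ : Unit) _ => ())
        (fun _ _ => (none : Option B)) (fun _ => none) () w = [] := by
      intro w
      induction w with
      | nil => rfl
      | cons x w ih => simp [QueryOrder.transduce, ih]
    simpa only [key] using (FP.encoding ea).transduce (fun (_ : Unit) _ => ())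
        (fun _ _ => (none : Option B)) (fun _ => none) ()
  | cons b w ih =>
    have key : ∀ w : List A, QueryOrder.transduce (fun (_ : Unit) _ => ())
        (fun _ _ => (none : Option B)) (fun _ => some b) () w = [b] := by
      intro w
      induction w with
      | nil => rfl
      | cons x w ih => simp [QueryOrder.transduce, ih]
    have := (FP.encoding ea).transduce (fun (_ : Unit) _ => ())
        (fun _ _ => (none : Option B)) (fun _ => some b) ()
    simp only [key] at this
    exact this.append ih

theorem FP.flatMap {I : Type*} (l : List I) {f : I → α → List B} (hf : ∀ i, FP ea (f i)) :
    FP ea fun a => l.flatMap fun i => f i a := by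
  induction l with
  | nil => exact FP.const []
  | cons i l ih => simpa using (hf i).append ih

theorem Dec.const (b : Bool) : Dec ea fun _ => b := FP.const [b]

theorem Dec.map {g : α → Bool} (hg : Dec ea g) (h : Bool → Bool) : Dec ea fun a => h (g a) :=
  FP.map (B := Bool) hg h

theorem Dec.map₂ {f g : α → Bool} (hf : Dec ea f) (hg : Dec ea g) (h : Bool → Bool → Bool) :
    Dec ea fun a => h (f a) (g a) :=
  -- The two bits form a word of length two; the transducer remembers the first and outputs at the
  -- second.
  (FP.append hf hg).transduce (fun (_ : Option Bool) x => some x)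
    (fun q x => q.map fun y => h y x) (fun _ => none) none

theorem Dec.ite {c f g : α → Bool} (hc : Dec ea c) (hf : Dec ea f) (hg : Dec ea g) :
    Dec ea fun a => if c a then f a else g a := by
  have := (hc.map₂ hf and).map₂ ((hc.map not).map₂ hg and) or
  convert this using 2 with a
  cases c a <;> simp

/-- The function `h` is arbitrary, because its finitely many values can be built into the program by
case distinctions. -/
theorem Dec.fin {n : ℕ} {g : Fin n → α → Bool} (hg : ∀ i, Dec ea (g i))
    (h : (Fin n → Bool) → Bool) : Dec ea fun a => h fun i => g i a := by
  induction n with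
  | zero =>
    have : (fun a => h fun i => g i a) = fun _ => h Fin.elim0 := by
      funext a; congr; funext i; exact i.elim0
    rw [this]; exact Dec.const _
  | succ n ih =>
    have := Dec.ite (hg 0) (ih (fun i => hg i.succ) fun v => h (Fin.cons true v))
      (ih (fun i => hg i.succ) fun v => h (Fin.cons false v))
    convert this using 2 with a
    have e : (fun i => g i a) = Fin.cons (g 0 a) fun i => g i.succ a :=
      (Fin.cons_self_tail fun i => g i a).symm
    rw [e]
    cases g 0 a <;> rfl

theorem Dec.pi {I : Type*} [Finite I] {g : I → α → Bool} (hg : ∀ i, Dec ea (g i))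
    (h : (I → Bool) → Bool) : Dec ea fun a => h fun i => g i a := by
  obtain ⟨n, ⟨e⟩⟩ := Finite.exists_equiv_fin I
  have := Dec.fin (fun i => hg (e.symm i)) fun v => h fun i => v (e i)
  simpa using this

end Closure

/-! ### Pairs of words and polynomial length bounds. -/

theorem encodePair_eq (z : Word × Word) : encodePair z = z.1.map Sum.inl ++ z.2.map Sum.inr := rfl

theorem FP.fst : FP encodePair Prod.fst := by
  have := (FP.encoding encodePair).filterMap (Sum.getLeft? : Bool ⊕ Bool → Option Bool)
  convert this using 2 with z
  have h₁ : (Sum.getLeft? : Bool ⊕ Bool → Option Bool) ∘ Sum.inl = some := rfl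
  have h₂ : (Sum.getLeft? : Bool ⊕ Bool → Option Bool) ∘ Sum.inr = fun _ => none := rfl
  simp [encodePair_eq, h₁, h₂]

theorem FP.snd : FP encodePair Prod.snd := by
  have := (FP.encoding encodePair).filterMap (Sum.getRight? : Bool ⊕ Bool → Option Bool)
  convert this using 2 with z
  have h₁ : (Sum.getRight? : Bool ⊕ Bool → Option Bool) ∘ Sum.inl = fun _ => none := rfl
  have h₂ : (Sum.getRight? : Bool ⊕ Bool → Option Bool) ∘ Sum.inr = some := rfl
  simp [encodePair_eq, h₁, h₂]

theorem FP.pair {α A : Type} [Finite A] [Inhabited A] {ea : α → List A} {f g : α → Word}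
    (hf : FP ea f) (hg : FP ea g) : FP ea fun a => encodePair (f a, g a) :=
  (hf.map Sum.inl).append (hg.map Sum.inr)

/-- In unary, addition is concatenation and multiplication is `Unary.fp_mul`. The result serves as a
yardstick for the length of witnesses. -/
theorem FP.polynomial {α A : Type} [Finite A] [Inhabited A] {ea : α → List A} {f : α → Word}
    (hf : FP ea f) (p : ℕ[X]) : FP ea fun a => List.replicate (p.eval (f a).length) true := by
  induction p using Polynomial.induction_on' with
  | add p q hp hq =>
    simpa only [eval_add, List.replicate_add] using hp.append hq
  | monomial n c =>
    induction n with
    | zero => simpa using FP.const (ea := ea) (List.replicate c true)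
    | succ n ih =>
      have h := FP.comp (ea := ea) (f := fun a => ((monomial n c).eval (f a).length, (f a).length))
        Unary.fp_mul (by
          simpa only [encodeUnaryPair, List.map_const'] using ih.append (hf.map fun _ => false))
      convert h using 3 with a
      simp [eval_monomial, pow_succ, mul_assoc]

theorem dec_length_le (p : ℕ[X]) :
    Dec encodePair fun z => decide (z.2.length ≤ p.eval z.1.length) := by
  refine FP.comp (f := fun z : Word × Word => (p.eval z.1.length, z.2.length)) Unary.fp_le ?_
  simpa only [encodeUnaryPair, List.map_const'] using
    (FP.fst.polynomial p).append (FP.snd.map fun _ => false)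

/-! ### Closure properties of `NP` -/

/-- A predicate in `NP`: a witness for `x` exists if and only if there is a short one. -/
def InNP (P : Word → Prop) : Prop :=
  ∃ (p : ℕ[X]) (V : Word × Word → Bool), Dec encodePair V ∧
    (∀ x y, V (x, y) = true → P x) ∧
    ∀ x, P x → ∃ y : Word, y.length ≤ p.eval x.length ∧ V (x, y) = true

/-- Once the length test is part of the verifier, any accepted witness is sound, however long. Later
constructions then need not check the length or the shape of a witness. -/
theorem inNP_iff {L : Language Bool} : InNP (fun x => x ∈ L) ↔ L ∈ NP := by
  constructor
  · rintro ⟨p, V, hV, h₁, h₂⟩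
    exact ⟨p, V, FP.computable hV, fun x => ⟨h₂ x, fun ⟨y, _, hy⟩ => h₁ x y hy⟩⟩
  · rintro ⟨p, V, ⟨hV⟩, h⟩
    refine ⟨p, _, Dec.map₂ (FP.of_computable hV) (dec_length_le p) and, fun x y hy => ?_,
      fun x hx => ?_⟩
    · simp only [Bool.and_eq_true, decide_eq_true_eq] at hy
      exact (h x).2 ⟨y, hy.2, hy.1⟩
    · obtain ⟨y, hy, hV⟩ := (h x).1 hx
      exact ⟨y, hy, by simp [hy, hV]⟩

theorem InNP.mem_NP {P : Word → Prop} (h : InNP P) : ({x | P x} : Set Word) ∈ NP :=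
  inNP_iff.1 h

theorem InNP.of_dec {g : Word → Bool} (hg : Dec (id : Word → Word) g) : InNP fun x => g x = true :=
  ⟨0, fun z => g z.1, hg.comp FP.fst, fun _ _ h => h, fun _ h => ⟨[], by simp, h⟩⟩

theorem InNP.const (P : Prop) : InNP fun _ => P := by
  classical
  simpa using InNP.of_dec (Dec.const (ea := (id : Word → Word)) (decide P))

theorem InNP.preimage {P : Word → Prop} (h : InNP P) {f : Word → Word}
    (hf : FP (id : Word → Word) f) : InNP fun x => P (f x) := by
  obtain ⟨p, V, hV, h₁, h₂⟩ := h
  obtain ⟨u, hu, hlen⟩ := hf.length_le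
  obtain ⟨q, hq⟩ := PolyBdd.comp p hu
  refine ⟨q, fun z => V (f z.1, z.2), ?_, fun x y => h₁ _ y, fun x hx => ?_⟩
  · exact Dec.comp (f := fun z : Word × Word => (f z.1, z.2)) hV
      (FP.pair (FP.comp (eb := (id : Word → Word)) hf FP.fst) FP.snd)
  · obtain ⟨y, hy, h⟩ := h₂ _ hx
    exact ⟨y, hy.trans ((polynomial_eval_mono p (hlen x)).trans (hq _)), h⟩

/-- The symbols of a word that are marked by `b`: at the even positions, the word has marks, and at
the odd positions, it has symbols. -/
def marked (b : Bool) : List Bool → List Bool :=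
  transduce (fun q x => match q with | none => some x | some _ => none)
    (fun q x => match q with | none => none | some c => if c = b then some x else none)
    (fun _ => none) none

theorem marked_append (b c : Bool) (w w' : List Bool) :
    marked b (w.flatMap (fun x => [c, x]) ++ w') = (if c = b then w else []) ++ marked b w' := by
  induction w with
  | nil => simp
  | cons x w ih =>
    have : marked b (c :: x :: (w.flatMap (fun x => [c, x]) ++ w')) =
        (if c = b then some x else none).toList ++
          marked b (w.flatMap (fun x => [c, x]) ++ w') := rfl
    simp only [List.flatMap_cons, List.cons_append, List.nil_append]
    rw [this, ih]
    split_ifs <;> simp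

/-- Two words as one word. -/
def interleave (w w' : Word) : Word :=
  w.flatMap (fun x => [false, x]) ++ (w'.flatMap (fun x => [true, x]) ++ [])

theorem marked_interleave (b : Bool) (w w' : Word) :
    marked b (interleave w w') = if b then w' else w := by
  rw [interleave, marked_append, marked_append]
  cases b <;> simp [marked, transduce]

theorem length_interleave (w w' : Word) :
    (interleave w w').length = w.length * 2 + w'.length * 2 := by
  simp [interleave, List.length_flatMap]

theorem Dec.marked {V : Word × Word → Bool} (hV : Dec encodePair V) (b : Bool) :
    Dec encodePair fun z => V (z.1, QueryOrder.marked b z.2) :=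
  Dec.comp (f := fun z : Word × Word => (z.1, QueryOrder.marked b z.2)) hV
    (FP.pair FP.fst (FP.snd.transduce _ _ _ _))

/-- Any word at all is split by `marked` into two candidate witnesses; soundness does not require
that it come from `interleave`. That encoding spends two letters per symbol, whence the factors `2`.
-/
theorem InNP.and {P Q : Word → Prop} (hP : InNP P) (hQ : InNP Q) : InNP fun x => P x ∧ Q x := by
  obtain ⟨p, V, hV, h₁, h₂⟩ := hP
  obtain ⟨q, W, hW, h₁', h₂'⟩ := hQ
  refine ⟨p * 2 + q * 2, _, (hV.marked false).map₂ (hW.marked true) Bool.and,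
    fun x y hy => ?_, fun x hx => ?_⟩
  · simp only [Bool.and_eq_true] at hy
    exact ⟨h₁ _ _ hy.1, h₁' _ _ hy.2⟩
  · obtain ⟨y, hy, h⟩ := h₂ x hx.1
    obtain ⟨y', hy', h'⟩ := h₂' x hx.2
    refine ⟨interleave y y', ?_, by simp [marked_interleave, h, h']⟩
    rw [length_interleave]
    simp only [eval_add, eval_mul, eval_ofNat]
    omega

theorem InNP.or {P Q : Word → Prop} (hP : InNP P) (hQ : InNP Q) : InNP fun x => P x ∨ Q x := by
  obtain ⟨p, V, hV, h₁, h₂⟩ := hP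
  obtain ⟨q, W, hW, h₁', h₂'⟩ := hQ
  refine ⟨p * 2 + q * 2, _, (hV.marked false).map₂ (hW.marked true) Bool.or,
    fun x y hy => ?_, fun x hx => ?_⟩
  · simp only [Bool.or_eq_true] at hy
    exact hy.imp (h₁ _ _) (h₁' _ _)
  · rcases hx with hx | hx
    · obtain ⟨y, hy, h⟩ := h₂ x hx
      refine ⟨interleave y [], ?_, by simp [marked_interleave, h]⟩
      rw [length_interleave]
      simp only [eval_add, eval_mul, eval_ofNat, List.length_nil]
      omega
    · obtain ⟨y, hy, h⟩ := h₂' x hx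
      refine ⟨interleave [] y, ?_, by simp [marked_interleave, h]⟩
      rw [length_interleave]
      simp only [eval_add, eval_mul, eval_ofNat, List.length_nil]
      omega

theorem InNP.exists {I : Type*} [Finite I] {P : I → Word → Prop} (h : ∀ i, InNP (P i)) :
    InNP fun x => ∃ i, P i x := by
  classical
  cases nonempty_fintype I
  have key : ∀ s : Finset I, InNP fun x => ∃ i ∈ s, P i x := by
    intro s
    induction s using Finset.induction_on with
    | empty => simpa using InNP.const False
    | insert i s _ ih => simpa using (h i).or ih
  simpa using key Finset.univ

theorem InNP.forall {I : Type*} [Finite I] {P : I → Word → Prop} (h : ∀ i, InNP (P i)) :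
    InNP fun x => ∀ i, P i x := by
  classical
  cases nonempty_fintype I
  have key : ∀ s : Finset I, InNP fun x => ∀ i ∈ s, P i x := by
    intro s
    induction s using Finset.induction_on with
    | empty => simpa using InNP.const True
    | insert i s _ ih => simpa using (h i).and ih
  simpa using key Finset.univ

/-! ### Mind changes -/

/-- `Alt α v j`: along some chain from `⊥` to `v`, the value of `α` changes `j` times. -/
inductive Alt {V : Type*} [PartialOrder V] [OrderBot V] (α : V → Bool) : V → ℕ → Prop
  | bot : Alt α ⊥ 0
  | same {u v : V} {j : ℕ} : Alt α u j → u ≤ v → α v = α u → Alt α v j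
  | flip {u v : V} {j : ℕ} : Alt α u j → u ≤ v → α v ≠ α u → Alt α v (j + 1)

namespace Alt

variable {V W : Type*} [PartialOrder V] [OrderBot V] [PartialOrder W] [OrderBot W]

theorem parity {α : V → Bool} {v : V} {j : ℕ} (h : Alt α v j) : α v = (α ⊥ ^^ j.bodd) := by
  induction h with
  | bot => simp
  | same _ _ h ih => rw [h, ih]
  | flip _ _ h ih =>
    rw [Nat.bodd_succ]
    revert h
    rw [ih]
    generalize α ⊥ = a
    rename_i v j _ _
    generalize α v = b
    generalize j.bodd = c
    revert a b c
    decide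

theorem step {α : V → Bool} {u v : V} {j : ℕ} (h : Alt α u j) (huv : u ≤ v) :
    ∃ j', Alt α v j' ∧ j ≤ j' ∧ (α v ≠ α u → j + 1 ≤ j') := by
  by_cases hα : α v = α u
  · exact ⟨j, .same h huv hα, le_rfl, fun h => absurd hα h⟩
  · exact ⟨j + 1, .flip h huv hα, by omega, fun _ => le_rfl⟩

theorem restrict {β : W → Bool} {r : V → W} (hr : Monotone r) (hb : r ⊥ = ⊥) {v : V} {j : ℕ}
    (h : Alt (fun v => β (r v)) v j) : Alt β (r v) j := by
  induction h with
  | bot => rw [hb]; exact .bot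
  | same _ huv h ih => exact .same ih (hr huv) h
  | flip _ huv h ih => exact .flip ih (hr huv) h

theorem const {b : Bool} {v : V} {j : ℕ} (h : Alt (fun _ => b) v j) : j = 0 := by
  induction h with
  | bot => rfl
  | same _ _ _ ih => exact ih
  | flip _ _ h => exact absurd rfl h

/-- All three functions are followed along the same chain. Where `γ` changes, either `h` changes, or
`h` is constant and the branch it selects changes. -/
theorem combine {γ h α β : V → Bool} (hγ : ∀ v, γ v = if h v then β v else α v) {v : V} {j : ℕ}
    (hj : Alt γ v j) :
    ∃ j₀ j₁ j₂, Alt h v j₀ ∧ Alt α v j₁ ∧ Alt β v j₂ ∧ j ≤ j₀ + j₁ + j₂ := by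
  induction hj with
  | bot => exact ⟨0, 0, 0, .bot, .bot, .bot, le_rfl⟩
  | same _ huv _ ih =>
    obtain ⟨j₀, j₁, j₂, h₀, h₁, h₂, hj⟩ := ih
    obtain ⟨i₀, h₀, k₀, -⟩ := h₀.step huv
    obtain ⟨i₁, h₁, k₁, -⟩ := h₁.step huv
    obtain ⟨i₂, h₂, k₂, -⟩ := h₂.step huv
    exact ⟨i₀, i₁, i₂, h₀, h₁, h₂, by omega⟩
  | @flip u v _ _ huv hne ih =>
    obtain ⟨j₀, j₁, j₂, h₀, h₁, h₂, hj⟩ := ih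
    obtain ⟨i₀, h₀, k₀, l₀⟩ := h₀.step huv
    obtain ⟨i₁, h₁, k₁, l₁⟩ := h₁.step huv
    obtain ⟨i₂, h₂, k₂, l₂⟩ := h₂.step huv
    refine ⟨i₀, i₁, i₂, h₀, h₁, h₂, ?_⟩
    rw [hγ, hγ] at hne
    by_cases e₀ : h v = h u
    · rw [e₀] at hne
      split_ifs at hne
      · have := l₂ hne; omega
      · have := l₁ hne; omega
    · have := l₀ e₀; omega

theorem coordinate {I : Type*} {i : I} {v : I → Bool} {j : ℕ}
    (h : Alt (fun v : I → Bool => v i) v j) : j ≤ (v i).toNat := by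
  induction h with
  | bot => simp
  | same _ _ h ih => rw [h]; exact ih
  | @flip u v j _ huv h ih =>
    have := huv i
    revert this ih h
    generalize u i = a
    generalize v i = b
    cases a <;> cases b <;> simp

/-- A change of value requires a change of assignment, and along a chain this means at least one new
true coordinate. -/
theorem le_card {I : Type*} [Fintype I] {α : (I → Bool) → Bool} {v : I → Bool} {j : ℕ}
    (h : Alt α v j) : j ≤ (Finset.univ.filter fun i => v i = true).card := by
  induction h with
  | bot => simp
  | same _ huv _ ih =>
    refine ih.trans (Finset.card_le_card fun i => ?_)
    simp only [Finset.mem_filter, Finset.mem_univ, true_and]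
    exact fun h => huv i h
  | @flip u v j _ huv hne ih =>
    refine Nat.succ_le_of_lt (lt_of_le_of_lt ih (Finset.card_lt_card ?_))
    rw [Finset.ssubset_iff_of_subset]
    · by_contra hcon
      push Not at hcon
      refine hne (congrArg α (funext fun i => ?_))
      have h₁ := hcon i
      have h₂ := huv i
      simp only [Finset.mem_filter, Finset.mem_univ, true_and] at h₁
      revert h₁ h₂
      cases u i <;> cases v i <;> simp
    · intro i
      simp only [Finset.mem_filter, Finset.mem_univ, true_and]
      exact fun h => huv i h

end Alt

/-! ### Boolean functions of `NP` predicates with few mind changes -/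

open Classical in
/-- `F` is a polynomial-time computable boolean function of finitely many `NP` predicates, and this
function makes at most `m` mind changes and has the value `b` at `⊥`. -/
def Rep (b : Word → Bool) (m : ℕ) (F : Word → Bool) : Prop :=
  ∃ (I : Type) (_ : Finite I) (E : I → Word → Prop) (α : Word → (I → Bool) → Bool),
    (∀ i, InNP (E i)) ∧ (∀ v, Dec (id : Word → Word) fun x => α x v) ∧
    (∀ x v j, Alt (α x) v j → j ≤ m) ∧ (∀ x, α x ⊥ = b x) ∧
    ∀ x, F x = α x fun i => decide (E i x)

theorem Rep.of_dec {F : Word → Bool} (hF : Dec (id : Word → Word) F) : Rep F 0 F :=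
  ⟨Empty, inferInstance, fun _ _ => False, fun x _ => F x, fun i => i.elim, fun _ => hF,
    fun _ _ _ h => h.const.le, fun _ => rfl, fun _ => rfl⟩

open Classical in
theorem Rep.of_inNP {P : Word → Prop} (hP : InNP P) :
    Rep (fun _ => false) 1 fun x => decide (P x) := by
  classical
  refine ⟨Unit, inferInstance, fun _ => P, fun _ v => v (), fun _ => hP, fun _ => Dec.const _,
    fun x v j h => h.coordinate.trans ?_, fun _ => rfl, fun _ => rfl⟩
  cases v () <;> simp

/-- The parity condition in `hM` is the source of the `- 1` in `mindChanges`. As `h` is false at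
`⊥`, an even number of changes of `h` means that it is false at the end as well. The combined
function then agrees with that of `F` at both ends of the chain, so their numbers of changes have
the same parity. -/
theorem Rep.ite {h F G b c : Word → Bool} {k m n M : ℕ} (hh : Rep (fun _ => false) k h)
    (hF : Rep b m F) (hG : Rep c n G)
    (hM : ∀ i₀ i₁ i₂ j : ℕ, i₀ ≤ k → i₁ ≤ m → i₂ ≤ n → j ≤ i₀ + i₁ + i₂ →
      (i₀.bodd = false → j.bodd = i₁.bodd) → j ≤ M) :
    Rep b M fun x => if h x then G x else F x := by
  classical
  obtain ⟨I, _, E, α, hE, hα, hk, hb, hh⟩ := hh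
  obtain ⟨I', _, E', α', hE', hα', hk', hb', hF⟩ := hF
  obtain ⟨I'', _, E'', α'', hE'', hα'', hk'', hb'', hG⟩ := hG
  refine ⟨I ⊕ I' ⊕ I'', inferInstance, Sum.elim E (Sum.elim E' E''),
    fun x v => if α x (fun i => v (.inl i)) then α'' x (fun i => v (.inr (.inr i)))
      else α' x (fun i => v (.inr (.inl i))), ?_, fun v => (hα _).ite (hα'' _) (hα' _), ?_, ?_, ?_⟩
  · rintro (i | i | i)
    exacts [hE i, hE' i, hE'' i]
  · intro x v j hj
    have hpar := hj.parity
    obtain ⟨i₀, i₁, i₂, h₀, h₁, h₂, hle⟩ := hj.combine (fun _ => rfl)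
    have l₀ := hk x _ _ (Alt.restrict (r := fun (v : I ⊕ I' ⊕ I'' → Bool) i => v (.inl i))
      (fun u v (huv : ∀ i, u i ≤ v i) i => huv _) rfl h₀)
    have l₁ := hk' x _ _ (Alt.restrict (r := fun (v : I ⊕ I' ⊕ I'' → Bool) i => v (.inr (.inl i)))
      (fun u v (huv : ∀ i, u i ≤ v i) i => huv _) rfl h₁)
    have l₂ := hk'' x _ _ (Alt.restrict (r := fun (v : I ⊕ I' ⊕ I'' → Bool) i => v (.inr (.inr i)))
      (fun u v (huv : ∀ i, u i ≤ v i) i => huv _) rfl h₂)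
    refine hM i₀ i₁ i₂ j l₀ l₁ l₂ hle fun hi₀ => ?_
    have p₀ := h₀.parity
    have p₁ := h₁.parity
    have e₀ : α x (fun i => (⊥ : I ⊕ I' ⊕ I'' → Bool) (.inl i)) = false := hb x
    rw [hi₀, Bool.xor_false, e₀] at p₀
    beta_reduce at hpar p₁
    rw [p₀, e₀] at hpar
    simp only [Bool.false_eq_true, if_false] at hpar
    rw [p₁] at hpar
    simpa using hpar.symm
  · intro x
    have e₀ : α x (fun i => (⊥ : I ⊕ I' ⊕ I'' → Bool) (.inl i)) = false := hb x
    beta_reduce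
    rw [e₀]
    exact hb' x
  · intro x
    beta_reduce
    rw [hh, hF, hG]
    rfl

/-- A function whose lower bounds are in `NP`. -/
def NPNumber (N : Word → ℕ) : Prop := ∀ j, InNP fun x => j ≤ N x

/-- `N x` is the largest number of changes along a chain that ends at an assignment whose true
variables are all confirmed. A witness consists of that end, the number of changes, and witnesses
for the confirmed predicates; the negative answers need no proof. -/
theorem Rep.exists_npNumber {b F : Word → Bool} {m : ℕ} (h : Rep b m F) :
    Dec (id : Word → Word) b ∧ ∃ N, NPNumber N ∧ (∀ x, N x ≤ m) ∧
      ∀ x, F x = (b x ^^ (N x).bodd) := by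
  classical
  obtain ⟨I, _, E, α, hE, hα, hm, hb, hF⟩ := h
  refine ⟨by simpa only [hb] using hα ⊥, ?_⟩
  let P : Word → ℕ → Prop := fun x j => ∃ v : I → Bool, (∀ i, v i = true → E i x) ∧ Alt (α x) v j
  have hP₀ : ∀ x, P x 0 := fun x => ⟨⊥, fun i h => by simp at h, .bot⟩
  let N : Word → ℕ := fun x => Nat.findGreatest (P x) m
  have hN : ∀ x, P x (N x) := fun x => Nat.findGreatest_spec (Nat.zero_le _) (hP₀ x)
  have hle : ∀ x j, P x j → j ≤ N x := fun x j hj =>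
    Nat.le_findGreatest (by obtain ⟨v, -, h⟩ := hj; exact hm x v j h) hj
  refine ⟨N, fun j => ?_, fun x => Nat.findGreatest_le _, fun x => ?_⟩
  · have key : ∀ x, j ≤ N x ↔ ∃ (v : I → Bool) (i : Fin (m + 1)),
        decide (j ≤ i.1 ∧ Alt (fun v => α x v) v i.1) = true ∧
        ∀ k : {k : I // v k = true}, E k.1 x := by
      intro x
      constructor
      · intro h
        obtain ⟨v, hv, ha⟩ := hN x
        exact ⟨v, ⟨N x, Nat.lt_succ_of_le (Nat.findGreatest_le _)⟩, by simpa using ⟨h, ha⟩,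
          fun k => hv k.1 k.2⟩
      · rintro ⟨v, i, h, hv⟩
        rw [decide_eq_true_eq] at h
        exact h.1.trans (hle x _ ⟨v, fun k hk => hv ⟨k, hk⟩, h.2⟩)
    simp only [key]
    refine InNP.exists fun v => InNP.exists fun i => InNP.and ?_ (InNP.forall fun k => hE k.1)
    -- Whether `Alt` holds depends only on the finite table of values of `α x`, each decidable in
    -- polynomial time.
    exact InNP.of_dec (Dec.pi hα fun t => decide (j ≤ i.1 ∧ Alt t v i.1))
  · obtain ⟨v, hv, ha⟩ := hN x
    have hvle : v ≤ fun i => decide (E i x) := fun i h => by simpa using hv i h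
    rw [hF, ← hb, ← ha.parity]
    by_contra hne
    -- Were the values different, extending the chain to the true assignment would give `N x + 1`
    -- changes.
    have := hle x _ ⟨_, fun i h => by simpa using h, .flip ha hvle hne⟩
    omega

theorem NPNumber.min {N : Word → ℕ} (h : NPNumber N) (c : ℕ) : NPNumber fun x => min (N x) c := by
  intro j
  simp only [le_min_iff]
  exact (h j).and (InNP.const _)

theorem NPNumber.sub {N : Word → ℕ} (h : NPNumber N) (c : ℕ) : NPNumber fun x => N x - c := by
  intro j
  have : ∀ x, j ≤ N x - c ↔ j = 0 ∨ j + c ≤ N x := fun x => by omega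
  simp only [this]
  exact (InNP.const _).or (h _)

/-! ### The boolean hierarchy -/

open Classical in
-- Membership in `A \ B` reads "if in `B` then false, else in `A`". The condition contributes `n +
-- 1` changes, `A` one, and the constant none.
theorem rep_of_mem_BH {n : ℕ} {L : Language Bool} (hL : L ∈ BH (n + 1)) {f : Word → Word}
    (hf : FP (id : Word → Word) f) : Rep (fun _ => false) (n + 1) fun x => decide (f x ∈ L) := by
  induction n generalizing L with
  | zero => exact Rep.of_inNP ((inNP_iff.2 hL).preimage hf)
  | succ n ih =>
    obtain ⟨A, hA, B, hB, rfl⟩ := hL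
    have := Rep.ite (M := n + 1 + 1) (ih hB) (Rep.of_inNP ((inNP_iff.2 hA).preimage hf))
      (Rep.of_dec (Dec.const false)) (by intros; omega)
    convert this using 2 with x
    by_cases hB : f x ∈ B
    · simp only [hB, decide_true, if_true, decide_eq_false_iff_not]
      exact fun h => h.2 hB
    · simp only [hB, decide_false, Bool.false_eq_true, if_false]
      rw [decide_eq_decide]
      exact ⟨fun h => h.1, fun h => ⟨h, hB⟩⟩

/-- The number of thresholds among `t 0, …, t (n - 1)` that are at most `N`. -/
def thresholdCount : (ℕ → ℕ) → ℕ → ℕ → ℕ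
  | _, 0, _ => 0
  | t, n + 1, N => (if t 0 ≤ N then 1 else 0) + thresholdCount (fun i => t (i + 1)) n N

theorem thresholdCount_eq_zero {t : ℕ → ℕ} {N : ℕ} (h : ∀ i, N < t i) (n : ℕ) :
    thresholdCount t n N = 0 := by
  induction n generalizing t with
  | zero => rfl
  | succ n ih => simp [thresholdCount, ih fun i => h (i + 1), Nat.not_le.2 (h 0)]

theorem thresholdCount_add (a n N : ℕ) :
    thresholdCount (fun i => a + i) n N = min (N + 1 - a) n := by
  induction n generalizing a with
  | zero => simp [thresholdCount]
  | succ n ih =>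
    have := ih (a + 1)
    simp only [thresholdCount]
    rw [show (fun i => a + (i + 1)) = fun i => a + 1 + i by funext i; ring, this]
    split_ifs <;> omega

/-- The count is odd exactly when the first threshold is reached and the number of later ones
reached is even, which is a difference of an NP set and a set of the preceding level. Monotonicity
ensures that no later threshold is reached before the first. -/
theorem thresholdCount_mem_BH {N : Word → ℕ} (hN : NPNumber N) {t : ℕ → ℕ} (ht : Monotone t)
    (n : ℕ) : ({x | (thresholdCount t (n + 1) (N x)).bodd = true} : Set Word) ∈ BH (n + 1) := by
  induction n generalizing t with
  | zero =>
    have h : ({x | (thresholdCount t (0 + 1) (N x)).bodd = true} : Set Word) = {x | t 0 ≤ N x} := by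
      ext x
      change (thresholdCount t (0 + 1) (N x)).bodd = true ↔ t 0 ≤ N x
      by_cases h : t 0 ≤ N x <;> simp [thresholdCount, h]
    rw [h]
    exact (hN (t 0)).mem_NP
  | succ n ih =>
    refine ⟨_, (hN (t 0)).mem_NP, _, ih (t := fun i => t (i + 1)) fun i j h => ht (by omega), ?_⟩
    ext x
    change (thresholdCount t (n + 1 + 1) (N x)).bodd = true ↔ t 0 ≤ N x ∧
      ¬ (thresholdCount (fun i => t (i + 1)) (n + 1) (N x)).bodd = true
    rw [thresholdCount]
    by_cases h : t 0 ≤ N x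
    · simp [h, Nat.bodd_add]
    · have : thresholdCount (fun i => t (i + 1)) (n + 1) (N x) = 0 :=
        thresholdCount_eq_zero (fun i => (Nat.not_le.1 h).trans_le (ht (by omega))) _
      simp [this, h]

/-! ### Strategies for trees of queries -/

/-- The result of walking down a tree of oracles `O` of the shape `T`, all queries being `x`: the
bit `b` with which the walk starts is changed at those nodes `node n l r` at which the walk turns
right and for which `mindChanges l` is even. -/
noncomputable def walk : BinaryTree ℕ+ → BinaryTree (Language Bool) → Word → Bool → Bool
  | .nil, _, _, b => b
  | .node .., .nil, _, b => b
  | .node _ l r, .node A O O', x, b =>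
    open Classical in
    if x ∈ A then walk r O' x (b ^^ (mindChanges l + 1).bodd) else walk l O x b

theorem bodd_eq_true_iff (n : ℕ) : n.bodd = true ↔ n % 2 = 1 := by
  rw [Nat.mod_two_of_bodd]; cases n.bodd <;> simp

theorem bodd_eq_false_iff (n : ℕ) : n.bodd = false ↔ n % 2 = 0 := by
  rw [Nat.mod_two_of_bodd]; cases n.bodd <;> simp

theorem bodd_eq_bodd_iff (n k : ℕ) : n.bodd = k.bodd ↔ n % 2 = k % 2 := by
  rw [Nat.mod_two_of_bodd, Nat.mod_two_of_bodd]; cases n.bodd <;> cases k.bodd <;> simp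

/-- The root oracle asks whether an odd number of `n` thresholds is reached, the first being
`mindChanges l + 1`. The subtrees receive truncated forms of `N`: up to `mindChanges l` the walk
goes left with `N` itself, and a right turn starts a new count at `mindChanges l + 1`, whose parity
is the bit that `walk` adds. -/
theorem exists_oracles (T : BinaryTree ℕ+) {N : Word → ℕ} (hN : NPNumber N)
    (hle : ∀ x, N x ≤ mindChanges T) :
    ∃ O, TreeRel (fun (n : ℕ+) A => A ∈ BH n) T O ∧ ∀ x b, walk T O x b = (b ^^ (N x).bodd) := by
  induction T generalizing N with
  | nil =>
    refine ⟨.nil, .nil, fun x b => ?_⟩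
    have : N x = 0 := by simpa [mindChanges] using hle x
    simp [walk, this]
  | node n l r ihl ihr =>
    obtain ⟨n, hn⟩ := n
    obtain ⟨k, rfl⟩ : ∃ k, n = k + 1 := ⟨n - 1, by omega⟩
    -- The number passed to the right is `N` shifted by `s` and capped at `c`; `d` is the extra gap
    -- between the first threshold and the second.
    obtain ⟨s, c, d, hc, hm⟩ : ∃ s c d : ℕ, c ≤ mindChanges r ∧
        ∀ N, N ≤ mindChanges (.node ⟨k + 1, hn⟩ l r) →
          let t := thresholdCount
            (fun i => mindChanges l + 1 + if i = 0 then 0 else d + i) (k + 1) N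
          (t.bodd = false → N.bodd = (min N (mindChanges l)).bodd) ∧
          (t.bodd = true → N.bodd = ((mindChanges l + 1).bodd ^^ (min (N - s) c).bodd)) := by
      generalize hL : mindChanges l = L
      generalize hR : mindChanges r = R
      have hT : mindChanges (.node ⟨k + 1, hn⟩ l r) =
          if (k + 1) % 2 = 0 ∧ R % 2 = 1 then k + L + R else k + 1 + L + R := by
        simp only [mindChanges, hL, hR, Nat.even_iff, Nat.odd_iff, PNat.mk_coe]
        split_ifs <;> omega
      rw [hT]
      simp only [← Nat.bodd_add, bodd_eq_bodd_iff, bodd_eq_true_iff, bodd_eq_false_iff]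
      rcases Nat.mod_two_eq_zero_or_one k with hk | hk
      -- Odd label: the thresholds `L + 1, …, L + k + 1` are consecutive. Between them the walk
      -- alternates between the right subtree with `0` and the left one with `L`; beyond the last it
      -- stays right, and all of `R` is available.
      · refine ⟨L + (k + 1), R, 0, le_rfl, fun N hN => ?_⟩
        have ht : (fun i => L + 1 + if i = 0 then 0 else 0 + i) = fun i => L + 1 + i := by
          funext i; split_ifs <;> omega
        rw [ht, thresholdCount_add]
        split_ifs at hN <;> constructor <;> intro h <;> omega
      -- Even label: beyond all thresholds the walk goes left, so the right subtree must be used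
      -- between the first threshold and the second. It counts up to the even part of `R` and stays
      -- there during the later alternation; an odd `R` loses one unit.
      · refine ⟨L + 1, R - R % 2, R - R % 2, by omega, fun N hN => ?_⟩
        rw [thresholdCount]
        have ht : (fun i => L + 1 + if i + 1 = 0 then 0 else R - R % 2 + (i + 1)) =
            fun i => L + 2 + (R - R % 2) + i := by
          funext i; simp only [Nat.add_one_ne_zero, if_false]; omega
        rw [ht, thresholdCount_add]
        simp only [if_true, add_zero]
        split_ifs at hN ⊢ <;> constructor <;> intro h <;> omega
    obtain ⟨O, hO, hOe⟩ := ihl (hN.min (mindChanges l)) fun x => by omega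
    obtain ⟨O', hO', hOe'⟩ := ihr ((hN.sub s).min c) fun x => by omega
    refine ⟨.node _ O O', .node (thresholdCount_mem_BH hN
      (t := fun i => mindChanges l + 1 + if i = 0 then 0 else d + i)
      (fun i j h => by dsimp only; split_ifs <;> omega) k) hO hO', fun x b => ?_⟩
    have := hm (N x) (hle x)
    by_cases h : (thresholdCount (fun i => mindChanges l + 1 + if i = 0 then 0 else d + i) (k + 1)
        (N x)).bodd = true
    · refine (if_pos (by exact h)).trans ?_
      rw [hOe', this.2 h, Bool.xor_assoc]
    · refine (if_neg (by exact h)).trans ?_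
      rw [hOe, this.1 (Bool.eq_false_iff.2 h)]

/-! ### Decoding the output of a truth-table reduction -/

/-- The part of a word after the first separator. -/
def dropBlock : List (Option Bool) → List (Option Bool) :=
  transduce (fun q x => q || x.isNone) (fun q x => if q then some x else none) (fun _ => none) false

/-- The part of a word before the first separator. -/
def firstBlock : List (Option Bool) → Word :=
  transduce (fun q x => q || x.isNone) (fun q x => if q then none else x) (fun _ => none) false

theorem dropBlock_append (w : Word) (r : List (Option Bool)) :
    dropBlock (w.map some ++ none :: r) = r := by
  induction w with
  | nil =>
    have : ∀ r : List (Option Bool), transduce (fun q x => q || x.isNone)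
        (fun q x => if q then some x else none) (fun _ => none) true r = r := by
      intro r
      induction r with
      | nil => rfl
      | cons x r ih => simp [transduce, ih]
    exact this r
  | cons x w ih => exact ih

theorem firstBlock_append (w : Word) (r : List (Option Bool)) :
    firstBlock (w.map some ++ none :: r) = w := by
  induction w with
  | nil =>
    have : ∀ r : List (Option Bool), transduce (fun q x => q || x.isNone)
        (fun q x => if q then none else x) (fun _ => none) true r = [] := by
      intro r
      induction r with
      | nil => rfl
      | cons x r ih => simp [transduce, ih]
    exact this r
  | cons x w ih => exact congrArg (x :: ·) ih

theorem dropBlock_iterate (l : List Word) (r : List (Option Bool)) {i : ℕ} (hi : i ≤ l.length) :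
    dropBlock^[i] (l.flatMap (fun w => w.map some ++ [none]) ++ r) =
      (l.drop i).flatMap (fun w => w.map some ++ [none]) ++ r := by
  induction i generalizing l with
  | zero => rfl
  | succ i ih =>
    match l with
    | [] => simp at hi
    | w :: l =>
      have : (w :: l).flatMap (fun w => w.map some ++ [none]) ++ r =
          w.map some ++ none :: (l.flatMap (fun w => w.map some ++ [none]) ++ r) := by simp
      rw [this, Function.iterate_succ_apply, dropBlock_append, ih l (by simpa using hi)]
      rfl

theorem firstBlock_encodeQueries {m : ℕ} (q : (Fin m → Word) × ((Fin m → Bool) → Bool))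
    (i : Fin m) : firstBlock (dropBlock^[(i : ℕ)] (encodeQueries m q)) = q.1 i := by
  rw [encodeQueries, dropBlock_iterate _ _ (by simp), List.drop_eq_getElem_cons (by simp)]
  simp only [List.flatMap_cons, List.append_assoc, List.singleton_append, List.getElem_ofFn]
  exact firstBlock_append _ _

theorem dropBlock_encodeQueries {m : ℕ} (q : (Fin m → Word) × ((Fin m → Bool) → Bool)) :
    dropBlock^[m] (encodeQueries m q) = (truthTable m q.2).map some := by
  rw [encodeQueries, dropBlock_iterate _ _ (by simp), List.drop_eq_nil_of_le (by simp)]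
  rfl

theorem length_truthTable (m : ℕ) (α : (Fin m → Bool) → Bool) :
    (truthTable m α).length = 2 ^ m := by
  induction m with
  | zero => rfl
  | succ m ih => simp [truthTable, ih, pow_succ, mul_two]

/-- The position `k` does not depend on `α`, so one fixed sequence of operations on the table
evaluates every predicate at `v`. -/
theorem exists_truthTable_getElem (m : ℕ) (v : Fin m → Bool) :
    ∃ k : ℕ, ∀ α, (truthTable m α)[k]? = some (α v) := by
  induction m with
  | zero => exact ⟨0, fun α => by simp [truthTable, Subsingleton.elim v Fin.elim0]⟩
  | succ m ih =>
    obtain ⟨k, hk⟩ := ih (Fin.tail v)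
    have hlt : ∀ α : (Fin m → Bool) → Bool, k < (truthTable m α).length := fun α =>
      (List.getElem?_eq_some_iff.1 (hk α)).1
    have hv := Fin.cons_self_tail v
    cases h : v 0 with
    | false =>
      refine ⟨k, fun α => ?_⟩
      rw [truthTable, List.getElem?_append_left (hlt _), hk, ← h, hv]
    | true =>
      refine ⟨2 ^ m + k, fun α => ?_⟩
      rw [truthTable, List.getElem?_append_right (by simp [length_truthTable]), length_truthTable,
        Nat.add_sub_cancel_left, hk, ← h, hv]

theorem FP.iterate {α A B : Type} [Finite A] {ea : α → List A} {f : α → List B}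
    {h : List B → List B} (hh : ∀ {f : α → List B}, FP ea f → FP ea fun a => h (f a))
    (hf : FP ea f) (n : ℕ) : FP ea fun a => h^[n] (f a) := by
  induction n with
  | zero => exact hf
  | succ n ih => simpa only [Function.iterate_succ_apply'] using hh ih

theorem Dec.head_eq {α A B : Type} [Finite A] [Inhabited A] [Finite B] [Inhabited B] [DecidableEq B]
    {ea : α → List A} {f : α → List B} (hf : FP ea f) (b : B) :
    Dec ea fun a => decide ((f a).head? = some b) := by
  have : ∀ w : List B, transduce (fun (q : Option B) x => q.or (some x))
      (fun _ _ => (none : Option Bool)) (fun q => some (decide (q = some b))) none w =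
        encodeBool (decide (w.head? = some b)) := by
    have key : ∀ (w : List B) (q : Option B), transduce (fun (q : Option B) x => q.or (some x))
        (fun _ _ => (none : Option Bool)) (fun q => some (decide (q = some b))) q w =
        encodeBool (decide (q.or w.head? = some b)) := by
      intro w
      induction w with
      | nil => intro q; cases q <;> rfl
      | cons x w ih =>
        intro q
        refine (ih _).trans ?_
        cases q <;> rfl
    exact fun w => key w none
  unfold Dec
  simpa only [this] using hf.transduce (B := Bool) (fun (q : Option B) x => q.or (some x))
    (fun _ _ => none) (fun q => some (decide (q = some b))) none

theorem exists_rep_of_mem_ttClosure {m : ℕ} {L : Language Bool} (h : L ∈ ttClosure m NP) :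
    ∃ b, Rep b m fun x => open Classical in decide (x ∈ L) := by
  classical
  obtain ⟨B, hB, f, ⟨hf⟩, h⟩ := h
  have hf : FP (id : Word → Word) fun x => encodeQueries m (f x) := FP.of_computable hf
  have hd : ∀ i, FP (id : Word → Word) fun x => dropBlock^[i] (encodeQueries m (f x)) :=
    FP.iterate (h := dropBlock) (fun h => h.transduce _ _ _ _) hf
  refine ⟨fun x => (f x).2 ⊥, Fin m, inferInstance, fun i x => (f x).1 i ∈ B, fun x => (f x).2,
    fun i => (inNP_iff.2 hB).preimage ?_, fun v => ?_, fun x v j h => h.le_card.trans ?_,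
    fun _ => rfl, fun x => ?_⟩
  · have : FP (id : Word → Word) fun x =>
        firstBlock (dropBlock^[(i : ℕ)] (encodeQueries m (f x))) :=
      (hd i).transduce _ _ _ _
    simpa only [firstBlock_encodeQueries] using this
  · obtain ⟨k, hk⟩ := exists_truthTable_getElem m v
    have h := hd m
    simp only [dropBlock_encodeQueries] at h
    have := Dec.head_eq (FP.iterate (fun h => h.tail) h k) (some true)
    convert this using 2 with x
    have htail : ∀ (l : List (Option Bool)) (k : ℕ), (List.tail^[k] l).head? = l[k]? := by
      intro l k
      induction k generalizing l with
      | zero => cases l <;> rfl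
      | succ k ih => rw [Function.iterate_succ_apply, ih]; cases l <;> simp
    rw [htail, List.getElem?_map, hk]
    change (f x).2 v = decide (Option.map some (some ((f x).2 v)) = some (some true))
    simp
  · exact (Finset.card_le_univ _).trans (by simp)
  · rw [Bool.eq_iff_iff, decide_eq_true_eq]
    convert h x

/-! ### Threshold queries -/

/-- The number of letters `true` at the beginning of a word is less than `m`, and the rest of the
word, without its first letter, satisfies the corresponding predicate. -/
def Threshold : ℕ → (ℕ → Word → Prop) → Word → Prop
  | 0, _, _ => False
  | m + 1, D, w => (w.head? = some false ∧ D 0 w.tail) ∨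
      (w.head? = some true ∧ Threshold m (fun j => D (j + 1)) w.tail)

theorem threshold_iff {m : ℕ} {D : ℕ → Word → Prop} {j : ℕ} (hj : j < m) (x : Word) :
    Threshold m D (List.replicate j true ++ false :: x) ↔ D j x := by
  induction m generalizing D j with
  | zero => omega
  | succ m ih =>
    cases j with
    | zero => simp [Threshold]
    | succ j => simpa [Threshold, List.replicate_succ] using ih (D := fun j => D (j + 1)) (by omega)

/-- This merges `m` NP predicates into one oracle, the index being given by the prefix of the query.
-/
theorem inNP_threshold (m : ℕ) {D : ℕ → Word → Prop} (hD : ∀ j, InNP (D j)) :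
    InNP (Threshold m D) := by
  induction m generalizing D with
  | zero => exact InNP.const False
  | succ m ih =>
    have ht : FP (id : Word → Word) List.tail := (FP.encoding id).tail
    have hh : ∀ b, InNP fun w => w.head? = some b := fun b => by
      simpa using InNP.of_dec (Dec.head_eq (FP.encoding (id : Word → Word)) b)
    exact ((hh _).and ((hD 0).preimage ht)).or
      ((hh _).and ((ih fun j => hD (j + 1)).preimage ht))

theorem truthTable_comp (g : Bool → Bool) {m : ℕ} (α : (Fin m → Bool) → Bool) :
    truthTable m (fun v => g (α v)) = (truthTable m α).map g := by
  induction m with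
  | zero => rfl
  | succ m ih => simp [truthTable, ih]

/-- The queries ask for `i + 1 ≤ N x` with `i < m`. Exactly `N x` of them are answered positively,
as `N x ≤ m`, so the parity of the positive answers is that of `N x`. -/
theorem mem_ttClosure_of_npNumber {m : ℕ} {L : Language Bool} {b : Word → Bool} {N : Word → ℕ}
    (hb : Dec (id : Word → Word) b) (hN : NPNumber N) (hle : ∀ x, N x ≤ m)
    (hL : ∀ x, x ∈ L ↔ (b x ^^ (N x).bodd) = true) : L ∈ ttClosure m NP := by
  classical
  let parity : (Fin m → Bool) → Bool := fun v => (Finset.univ.filter fun i => v i = true).card.bodd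
  refine ⟨_, (inNP_threshold m (D := fun j x => j + 1 ≤ N x) fun j => hN (j + 1)).mem_NP,
    fun x => (fun i => List.replicate i true ++ false :: x, fun v => b x ^^ parity v),
    FP.computable ?_, fun x => ?_⟩
  · have h₁ : ∀ i : Fin m, FP (id : Word → Word) fun x =>
        (List.replicate (i : ℕ) true ++ false :: x).map some ++ [none] := fun i => by
      have := (FP.const (ea := (id : Word → Word)) (List.replicate (i : ℕ) true ++ [false])).append
        (FP.encoding id)
      simpa using (this.map some).append (FP.const [none])
    -- The table of `parity` is a fixed word, and `b x` is added to each of its letters.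
    have h₂ : ∀ l : Word, FP (id : Word → Word) fun x => (l.map (b x ^^ ·)).map some := fun l => by
      simpa only [← List.map_eq_flatMap] using
        (FP.flatMap l (f := fun c x => [b x ^^ c]) fun c => hb.map (· ^^ c)).map some
    have h₃ := (FP.flatMap (List.finRange m) h₁).append (h₂ (truthTable m parity))
    convert h₃ using 2 with x
    rw [encodeQueries, List.ofFn_eq_map, List.flatMap_map, truthTable_comp (b x ^^ ·)]
  · rw [hL]
    have hmem : ∀ i : Fin m, (List.replicate (i : ℕ) true ++ false :: x) ∈
        ({w | Threshold m (fun j x => j + 1 ≤ N x) w} : Set Word) ↔ (i : ℕ) < N x :=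
      fun i => threshold_iff i.2 x
    have hcard : (Finset.univ.filter fun i : Fin m => (i : ℕ) < N x).card = N x := by
      rw [Fin.card_filter_val_lt, min_eq_right (hle x)]
    have : parity (fun i => decide ((List.replicate (i : ℕ) true ++ false :: x) ∈
        ({w | Threshold m (fun j x => j + 1 ≤ N x) w} : Set Word))) = (N x).bodd := by
      simp only [parity, hmem, decide_eq_true_eq, hcard]
    rw [← this]
    exact Iff.rfl

/-! ### Oracle machines that walk down a tree of queries -/

/-- The set of all subtrees of a binary tree. -/
def subtrees {α : Type} : BinaryTree α → Set (BinaryTree α)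
  | .nil => {.nil}
  | .node a l r => insert (.node a l r) (subtrees l ∪ subtrees r)

theorem finite_subtrees {α : Type} (T : BinaryTree α) : (subtrees T).Finite := by
  induction T with
  | nil => exact Set.finite_singleton _
  | node a l r ihl ihr => exact (ihl.union ihr).insert _

theorem self_mem_subtrees {α : Type} (T : BinaryTree α) : T ∈ subtrees T := by
  cases T with
  | nil => exact rfl
  | node a l r => exact Or.inl rfl

theorem child_mem_subtrees {α : Type} {S T : BinaryTree α} (h : S ∈ subtrees T) :
    S.left ∈ subtrees T ∧ S.right ∈ subtrees T := by
  induction T with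
  | nil => cases h; exact ⟨rfl, rfl⟩
  | node a l r ihl ihr =>
    rcases h with rfl | h | h
    · exact ⟨.inr (.inl (self_mem_subtrees l)), .inr (.inr (self_mem_subtrees r))⟩
    · exact ⟨.inr (.inl (ihl h).1), .inr (.inl (ihl h).2)⟩
    · exact ⟨.inr (.inr (ihr h).1), .inr (.inr (ihr h).2)⟩

/-- The trivial tree has no root. -/
def hasRoot {α : Type} : BinaryTree α → Bool
  | .nil => false
  | .node .. => true

theorem OracleTM.step_of_ne (M : OracleTM) {c : M.tm.Cfg} (h : c.l ≠ some M.ask)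
    (O : BinaryTree (Language Bool)) :
    M.step (c, O) = (M.tm.step c).map fun c' => (c', O) :=
  if_neg h

theorem OracleTM.step_halted (M : OracleTM) {c : M.tm.Cfg} (h : c.l = none)
    (O : BinaryTree (Language Bool)) : M.step (c, O) = none := by
  obtain ⟨l, v, S⟩ := c
  cases h
  exact M.step_of_ne (c := ⟨none, v, S⟩) (by nofun) O

namespace Walk

variable (T : BinaryTree ℕ+) (M : TM2ComputableAux Bool Bool)

def Alph : M.tm.K ⊕ Bool → Type
  | .inl k => M.tm.Γ k
  | .inr _ => Bool

abbrev Lab : Type := M.tm.Λ ⊕ Fin 7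

abbrev State : Type := M.tm.σ × Option Bool × Bool × {S // S ∈ subtrees T}

/-- First, the machine `M` computes a bit and a word. Then the query tape is filled with this word
at every node. -/
def prog : Lab M → TM2.Stmt (Alph M) (Lab M) (State T M)
  | .inl l => liftStmt (Γ' := Alph M) Sum.inl Prod.fst (fun v s => (v, s.2)) Sum.inl
      (.goto fun _ => .inr 0) (M.tm.m l)
  | .inr 0 => .pop (.inl M.tm.k₁)
      (fun s o => (s.1, s.2.1, (o.map M.outputAlphabet).getD false, s.2.2.2))
      (.goto fun _ => .inr 1)
  | .inr 1 => .branch (fun s => hasRoot s.2.2.2.1) (.goto fun _ => .inr 2) .halt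
  | .inr 2 => moveStmt (Γ := Alph M) (.inl M.tm.k₁) (.inr false)
      (fun o s => (s.1, o, s.2.2)) (fun s => s.2.1) M.outputAlphabet id (.inr 2) (.inr 3)
  | .inr 3 => copyStmt (Γ := Alph M) (.inr false) (.inl M.tm.k₁) (.inr true)
      (fun o s => (s.1, o, s.2.2)) (fun s => s.2.1) id M.outputAlphabet.symm id (.inr 3) (.inr 4)
  | .inr 4 => .halt
  | .inr 5 => .load (fun s => (s.1, s.2.1, s.2.2.1 ^^ (mindChanges s.2.2.2.1.left + 1).bodd,
      ⟨s.2.2.2.1.right, (child_mem_subtrees s.2.2.2.2).2⟩)) (.goto fun _ => .inr 1)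
  | .inr 6 => .load (fun s => (s.1, s.2.1, s.2.2.1,
      ⟨s.2.2.2.1.left, (child_mem_subtrees s.2.2.2.2).1⟩)) (.goto fun _ => .inr 1)

noncomputable def machine : OracleTM :=
  let := M.tm.kFin
  let := M.tm.ΛFin
  let := M.tm.σFin
  let := (finite_subtrees T).fintype
  { tm :=
      { K := M.tm.K ⊕ Bool
        k₀ := .inl M.tm.k₀
        k₁ := .inr true
        Γ := Alph M
        Λ := Lab M
        main := .inl M.tm.main
        σ := State T M
        initialState := (M.tm.initialState, none, false, ⟨T, self_mem_subtrees T⟩)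
        Γk₀Fin := M.tm.Γk₀Fin
        m := prog T M }
    inputAlphabet := M.inputAlphabet
    outputAlphabet := Equiv.refl Bool
    ask := .inr 4
    yes := .inr 5
    no := .inr 6
    accept := fun s => s.2.2.1 }

variable {T M}

theorem step_eq {l : Lab M} (h : l ≠ .inr 4) (s : State T M) (S : ∀ k, List (Alph M k))
    (O : BinaryTree (Language Bool)) :
    (machine T M).step (⟨some l, s, S⟩, O) = some (TM2.stepAux (prog T M l) s S, O) :=
  (machine T M).step_of_ne (c := ⟨some l, s, S⟩) (fun e => h (Option.some.inj e)) O

/-- A query erases the query tape, so at each node `x` is copied from the output stack of `M`, by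
way of an auxiliary stack. Per node this takes two loops of `|x| + 1` steps and three single steps.
-/
theorem reach_walk {T' : BinaryTree ℕ+} {O : BinaryTree (Language Bool)}
    (h : TreeRel (fun _ _ => True) T' O) {x : Word} (v : M.tm.σ) (o : Option Bool) (b : Bool)
    (hT : T' ∈ subtrees T) (S : ∀ k, List (Alph M k))
    (hx : List.map M.outputAlphabet (S (.inl M.tm.k₁)) = x) (h₁ : S (.inr false) = [])
    (h₂ : S (.inr true) = []) :
    ∃ (c : (machine T M).tm.Cfg) (O' : BinaryTree (Language Bool)),
      Reach (machine T M).step (⟨some (.inr 1), (v, o, b, ⟨T', hT⟩), S⟩, O) (c, O')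
        (T'.numNodes * (2 * x.length + 5) + 1) ∧
      c.l = none ∧ (machine T M).accept c.var = walk T' O x b := by
  induction h generalizing v o b S with
  | nil =>
    exact ⟨⟨none, (v, o, b, ⟨.nil, hT⟩), S⟩, .nil,
      (Reach.one (step_eq (by simp) _ _ _)).mono (by simp), rfl, rfl⟩
  | @node n A l r O O' _ _ _ ihl ihr =>
    have e₁ : (machine T M).step (⟨some (.inr 1), (v, o, b, ⟨.node n l r, hT⟩), S⟩, .node A O O') =
      some (⟨some (.inr 2), (v, o, b, ⟨.node n l r, hT⟩), S⟩, .node A O O') :=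
      step_eq (by simp) _ _ _
    obtain ⟨s₂, S₂, p₂, a₂, b₂, c₂, r₂⟩ := reach_move (Γ := Alph M) (st := (machine T M).step)
      (emb := fun c => (c, .node A O O')) (l := .inr 2) (ret := .inr 3) (a := .inl M.tm.k₁)
      (b := .inr false) (wr := fun o s => (s.1, o, s.2.2)) (rd := fun s => s.2.1)
      (i := M.outputAlphabet) (f := id) (by simp) (fun s S => step_eq (by simp) _ _ _)
      (fun o s => rfl) (fun s => s.2.2 = (b, ⟨.node n l r, hT⟩)) (fun o s h => h)
      (v, o, b, ⟨.node n l r, hT⟩) S rfl hx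
    rw [h₁] at b₂
    have b₂ : S₂ (.inr false) = x.reverse :=
      b₂.trans ((List.append_nil _).trans (List.map_id _))
    obtain ⟨s₃, S₃, p₃, a₃, b₃, d₃, c₃, r₃⟩ := reach_copy (Γ := Alph M)
      (st := (machine T M).step)
      (emb := fun c => (c, .node A O O')) (l := .inr 3) (ret := .inr 4) (a := .inr false)
      (b := .inl M.tm.k₁) (c := .inr true) (wr := fun o s => (s.1, o, s.2.2)) (rd := fun s => s.2.1)
      (i := id) (f := M.outputAlphabet.symm) (f' := id) (by simp) (by simp) (by simp)
      (fun s S => step_eq (by simp) _ _ _)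
      (fun o s => rfl) (fun s => s.2.2 = (b, ⟨.node n l r, hT⟩)) (fun o s h => h)
      s₂ S₂ p₂ ((List.map_id _).trans b₂)
    rw [List.reverse_reverse, a₂] at b₃
    rw [List.reverse_reverse, c₂ (.inr true) (by simp) (by simp), h₂] at d₃
    have d₃ : S₃ (.inr true) = x := d₃.trans ((List.append_nil _).trans (List.map_id _))
    have b₃ : List.map M.outputAlphabet (S₃ (.inl M.tm.k₁)) = x := by
      rw [b₃]
      refine (congrArg _ (List.append_nil _)).trans (List.map_map.trans ?_)
      rw [Equiv.self_comp_symm]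
      exact List.map_id _
    obtain ⟨v₃, o₃, q₃⟩ := s₃
    cases p₃
    have hq : (machine T M).query ⟨some (.inr 4), (v₃, o₃, b, ⟨.node n l r, hT⟩), S₃⟩ = x :=
      (List.map_id _).trans d₃
    let S₄ : ∀ k, List (Alph M k) := Function.update S₃ (.inr true) []
    have hx₄ : List.map M.outputAlphabet (S₄ (.inl M.tm.k₁)) = x := by
      rw [← b₃]
      exact congrArg _ (Function.update_of_ne (by simp) _ _)
    have h₁₄ : S₄ (.inr false) = [] := (Function.update_of_ne (by simp) _ _).trans a₃
    have h₂₄ : S₄ (.inr true) = [] := Function.update_self _ _ _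
    have r₁ := ((Reach.one e₁).trans r₂).trans r₃
    rw [List.length_reverse] at r₁
    by_cases hA : x ∈ A
    · have e₄ : (machine T M).step
          (⟨some (.inr 4), (v₃, o₃, b, ⟨.node n l r, hT⟩), S₃⟩, .node A O O') =
          some (⟨some (.inr 5), (v₃, o₃, b, ⟨.node n l r, hT⟩), S₄⟩, O') := by
        refine (if_pos rfl).trans ((if_pos ?_).trans rfl)
        rw [hq]
        exact hA
      obtain ⟨c, O'', i₁, i₂, i₃⟩ := ihr v₃ o₃ (b ^^ (mindChanges l + 1).bodd)
        (child_mem_subtrees hT).2 S₄ hx₄ h₁₄ h₂₄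
      refine ⟨c, O'', ((r₁.trans (.one e₄)).trans
        (Reach.head (step_eq (by simp) _ _ _) i₁)).mono ?_,
        i₂, i₃.trans (if_pos hA).symm⟩
      simp only [BinaryTree.numNodes, Nat.add_mul]
      omega
    · have e₄ : (machine T M).step
          (⟨some (.inr 4), (v₃, o₃, b, ⟨.node n l r, hT⟩), S₃⟩, .node A O O') =
          some (⟨some (.inr 6), (v₃, o₃, b, ⟨.node n l r, hT⟩), S₄⟩, O) := by
        refine (if_pos rfl).trans ((if_neg ?_).trans rfl)
        rw [hq]
        exact hA
      obtain ⟨c, O'', i₁, i₂, i₃⟩ := ihl v₃ o₃ b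
        (child_mem_subtrees hT).1 S₄ hx₄ h₁₄ h₂₄
      refine ⟨c, O'', ((r₁.trans (.one e₄)).trans
        (Reach.head (step_eq (by simp) _ _ _) i₁)).mono ?_,
        i₂, i₃.trans (if_neg hA).symm⟩
      simp only [BinaryTree.numNodes, Nat.add_mul]
      omega

end Walk

/-! ### From threshold numbers to oracle machines. -/

theorem OracleTM.HaltsWith.unique {M : OracleTM} {O : BinaryTree (Language Bool)} {x : Word}
    {t t' : ℕ} {b b' : Bool} (h : M.HaltsWith O x t b) (h' : M.HaltsWith O x t' b') : b = b' := by
  obtain ⟨c, Oc, h, hl, rfl⟩ := h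
  obtain ⟨d, Od, h', hl', rfl⟩ := h'
  obtain ⟨n, -, h⟩ := reach_iff.2 h
  obtain ⟨k, -, h'⟩ := reach_iff.2 h'
  have := h.unique (M.step_halted hl _) h' (M.step_halted hl' _)
  rw [(Prod.mk.inj this).1]

theorem TreeRel.mono {α β : Type} {R R' : α → β → Prop} (hR : ∀ a b, R a b → R' a b)
    {S : BinaryTree α} {T : BinaryTree β} (h : TreeRel R S T) : TreeRel R' S T := by
  induction h with
  | nil => exact .nil
  | node h _ _ ihl ihr => exact .node (hR _ _ h) ihl ihr

-- The machine and its time bound are fixed before the oracles, as the clause on arbitrary oracles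
-- in `PTree` demands. It computes `b x` beforehand and carries the bit along the walk.
open Walk in
theorem exists_oracleTM (T : BinaryTree ℕ+) {b : Word → Bool} (hb : Dec (id : Word → Word) b) :
    ∃ (M : OracleTM) (p : ℕ[X]), ∀ O : BinaryTree (Language Bool), TreeRel (fun _ _ => True) T O →
      ∀ x : Word, M.HaltsWith O x (p.eval x.length) (walk T O x (b x)) := by
  obtain ⟨M, t, ⟨p, hp⟩, hM⟩ := hb.append (FP.encoding (id : Word → Word))
  refine ⟨machine T M, p + 1 + (C T.numNodes * (2 * X + 5) + 1), fun O hO x => ?_⟩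
  obtain ⟨d, ⟨n, hn, hd⟩, hdl, hdo⟩ := hM x
  have hS₀ : ∀ k, Function.update (fun _ => [] : ∀ k, List (Alph M k)) (Sum.inl M.tm.k₀)
      (x.map M.inputAlphabet.symm) (.inl k) =
      Function.update (fun _ => [] : ∀ k, List (M.tm.Γ k)) M.tm.k₀
        (x.map M.inputAlphabet.symm) k :=
    startStk_comp (Γ' := Alph M) Sum.inl_injective _ _
  obtain ⟨w, S₁, h₁, h₁', h₁''⟩ := steps_lift (Γ' := Alph M) Sum.inl_injective isLens_fst
    (lab := Sum.inl) (ret := .inr 0) (m := M.tm.m) (st := (machine T M).step)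
    (emb := fun c => (c, O)) (fun l s S => step_eq (by simp) _ _ _) hd hdl
    (s := (M.tm.initialState, none, false, ⟨T, self_mem_subtrees T⟩))
    (S := Function.update (fun _ => []) (Sum.inl M.tm.k₀) (x.map M.inputAlphabet.symm))
    rfl hS₀
  have h₁e : ∀ k, S₁ (.inr k) = [] := fun k => by
    rw [h₁'' _ (by simp), Function.update_of_ne (by simp)]
  have hout : List.map M.outputAlphabet (S₁ (.inl M.tm.k₁)) = b x :: x :=
    (congrArg _ (h₁' _)).trans hdo
  let S₂ : ∀ k, List (Alph M k) := Function.update S₁ (.inl M.tm.k₁) (S₁ (.inl M.tm.k₁)).tail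
  have hx₂ : List.map M.outputAlphabet (S₂ (.inl M.tm.k₁)) = x := by
    rw [show S₂ (.inl M.tm.k₁) = (S₁ (.inl M.tm.k₁)).tail from Function.update_self _ _ _]
    rw [← List.tail_cons (a := b x) (as := x), ← hout]
    exact (List.map_tail (f := M.outputAlphabet) (l := S₁ (.inl M.tm.k₁)))
  have e₂ : (machine T M).step
      (⟨some (.inr 0), (w, none, false, ⟨T, self_mem_subtrees T⟩), S₁⟩, O) =
      some (⟨some (.inr 1), (w, none, b x, ⟨T, self_mem_subtrees T⟩), S₂⟩, O) := by
    refine (step_eq (by simp) _ _ _).trans ?_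
    have : ((S₁ (.inl M.tm.k₁)).head?.map M.outputAlphabet).getD false = b x := by
      have := congrArg List.head? hout
      exact congrArg (·.getD false) (List.head?_map.symm.trans this)
    simp only [prog, TM2.stepAux, this]
    rfl
  obtain ⟨c, O', h₃, hc, ha⟩ := reach_walk hO w none (b x) (self_mem_subtrees T) S₂ hx₂
    ((Function.update_of_ne (by simp) _ _).trans (h₁e _))
    ((Function.update_of_ne (by simp) _ _).trans (h₁e _))
  refine ⟨c, O', reach_iff.1 ?_, hc, ha⟩
  rw [OracleTM.init, initList_eq]
  refine ((Reach.trans ⟨n, le_rfl, h₁⟩ (.one e₂)).trans h₃).mono ?_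
  have := hn.trans (hp _)
  simp only [eval_add, eval_mul, eval_C, eval_X, eval_one, eval_ofNat, id] at this ⊢
  omega

theorem mem_PTree_of_npNumber {T : BinaryTree ℕ+} {L : Language Bool} {b : Word → Bool}
    {N : Word → ℕ} (hb : Dec (id : Word → Word) b) (hN : NPNumber N)
    (hle : ∀ x, N x ≤ mindChanges T) (hL : ∀ x, x ∈ L ↔ (b x ^^ (N x).bodd) = true) :
    L ∈ PTree T := by
  obtain ⟨M, p, hM⟩ := exists_oracleTM T hb
  obtain ⟨O, hO, hw⟩ := exists_oracles T hN hle
  refine ⟨M, p, fun O hO x => ⟨_, hM O hO x⟩, O, hO, fun x => ?_⟩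
  have h := hM O (hO.mono fun _ _ _ => trivial) x
  rw [hL, ← hw]
  exact ⟨fun e => e ▸ h, fun h' => h.unique h'⟩

/-! ### Oracle machines with prescribed answers -/

namespace OracleTM

variable (M : OracleTM)

open Classical in
/-- One step of an oracle machine whose queries are answered by a list of answers. -/
noncomputable def listStep : M.tm.Cfg × List Bool → Option (M.tm.Cfg × List Bool)
  | (c, a) =>
    if c.l = some M.ask then
      match a with
      | [] => none
      | b :: a => some (M.resume c (if b then M.yes else M.no), a)
    else (M.tm.step c).map fun c' => (c', a)

theorem listStep_of_ne {c : M.tm.Cfg} (h : c.l ≠ some M.ask) (a : List Bool) :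
    M.listStep (c, a) = (M.tm.step c).map fun c' => (c', a) :=
  if_neg h

theorem listStep_nil {c : M.tm.Cfg} (h : c.l = some M.ask) : M.listStep (c, []) = none :=
  if_pos h

theorem listStep_cons {c : M.tm.Cfg} (h : c.l = some M.ask) (b : Bool) (a : List Bool) :
    M.listStep (c, b :: a) = some (M.resume c (if b then M.yes else M.no), a) :=
  if_pos h

theorem listStep_halted {c : M.tm.Cfg} (h : c.l = none) (a : List Bool) :
    M.listStep (c, a) = none := by
  obtain ⟨l, v, S⟩ := c
  cases h
  exact M.listStep_of_ne (c := ⟨none, v, S⟩) (by nofun) a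

theorem step_nil {c : M.tm.Cfg} (h : c.l = some M.ask) : M.step (c, .nil) = none :=
  if_pos h

theorem step_yes {c : M.tm.Cfg} (h : c.l = some M.ask) {A : Language Bool} (hA : M.query c ∈ A)
    (O O' : BinaryTree (Language Bool)) :
    M.step (c, .node A O O') = some (M.resume c M.yes, O') :=
  (if_pos h).trans (if_pos hA)

theorem step_no {c : M.tm.Cfg} (h : c.l = some M.ask) {A : Language Bool} (hA : M.query c ∉ A)
    (O O' : BinaryTree (Language Bool)) :
    M.step (c, .node A O O') = some (M.resume c M.no, O) :=
  (if_pos h).trans (if_neg hA)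

end OracleTM

namespace Simulation

variable (M : OracleTM) (a : List Bool)

def Alph : M.tm.K ⊕ Unit → Type
  | .inl k => M.tm.Γ k
  | .inr _ => Bool

abbrev Lab : Type := M.tm.Λ ⊕ Bool

abbrev State : Type := M.tm.σ × {l : List Bool // l <:+ a} × Bool

open Classical in
/-- A simulation of the oracle machine `M` with the answers `a`. It ends when `M` halts, or when the
answers are exhausted. -/
noncomputable def prog : Lab M → TM2.Stmt (Alph M) (Lab M) (State M a)
  | .inl l => if l = M.ask then
        .branch (fun s => s.2.1.1.isEmpty) (.push (.inr ()) (fun s => M.accept s.1) .halt)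
          (.load (fun s => (s.1, ⟨s.2.1.1.tail, (List.tail_suffix _).trans s.2.1.2⟩,
            s.2.1.1.headD false)) (.goto fun s => .inr s.2.2))
      else liftStmt (Γ' := Alph M) Sum.inl Prod.fst (fun v s => (v, s.2)) Sum.inl
        (.push (.inr ()) (fun s => M.accept s.1) .halt) (M.tm.m l)
  | .inr b => .pop (.inl M.tm.k₁) (fun s o => (s.1, s.2.1, o.isSome))
      (.branch (fun s => s.2.2) (.goto fun _ => .inr b)
        (.goto fun _ => .inl (if b then M.yes else M.no)))

variable {M a}

theorem prog_ask : prog M a (.inl M.ask) =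
    .branch (fun s => s.2.1.1.isEmpty) (.push (.inr ()) (fun s => M.accept s.1) .halt)
      (.load (fun s => (s.1, ⟨s.2.1.1.tail, (List.tail_suffix _).trans s.2.1.2⟩,
        s.2.1.1.headD false)) (.goto fun s => .inr s.2.2)) :=
  if_pos rfl

theorem prog_of_ne {l : M.tm.Λ} (h : l ≠ M.ask) : prog M a (.inl l) =
    liftStmt (Γ' := Alph M) Sum.inl Prod.fst (fun v s => (v, s.2)) Sum.inl
      (.push (.inr ()) (fun s => M.accept s.1) .halt) (M.tm.m l) :=
  if_neg h

/-- The oracle machine erases its query tape in one step, whereas the simulation pops it symbol by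
symbol. With `B` bounding the length of that tape throughout, each simulated step costs at most `B +
2`. -/
theorem reach_simulation {C₀ B : ℕ} (hC : ∀ l, pushCount (M.tm.m l) ≤ C₀) {n : ℕ} {q : M.tm.Λ}
    {v : M.tm.σ} {R : ∀ k, List (M.tm.Γ k)} {l l' : List Bool} {d : M.tm.Cfg}
    (h : Steps M.listStep n (⟨some q, v, R⟩, l) (d, l'))
    (hd : d.l = none ∨ (d.l = some M.ask ∧ l' = []))
    (hB : (R M.tm.k₁).length + n * C₀ ≤ B) (hl : l <:+ a) (y : Bool) (S : ∀ k, List (Alph M k))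
    (hS : ∀ k, S (.inl k) = R k) (hS' : S (.inr ()) = []) :
    ∃ e : TM2.Cfg (Alph M) (Lab M) (State M a),
      Reach (TM2.step (prog M a)) ⟨some (.inl q), (v, ⟨l, hl⟩, y), S⟩ e (n * (B + 2) + 1) ∧
      e.l = none ∧ (∀ k, e.stk (.inl k) = d.stk k) ∧ e.stk (.inr ()) = [M.accept d.var] := by
  induction n generalizing q v R l y S with
  | zero =>
    cases h
    obtain ⟨hq, rfl⟩ := hd.resolve_left (by nofun)
    cases hq
    have e₁ : TM2.step (prog M a) ⟨some (.inl M.ask), (v, ⟨[], hl⟩, y), S⟩ =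
        some ⟨none, (v, ⟨[], hl⟩, y), Function.update S (.inr ()) (M.accept v :: S (.inr ()))⟩ := by
      simp only [TM2.step, prog_ask]
      rfl
    refine ⟨_, (Reach.one e₁).mono (by omega), rfl, fun k => ?_, ?_⟩
    · refine Eq.trans ?_ (hS k)
      exact Function.update_of_ne (β := fun k => List (Alph M k))
        (Sum.inl_ne_inr : .inl k ≠ Sum.inr ()) (M.accept v :: S (.inr ())) S
    · refine Eq.trans ?_ (congrArg (List.cons (α := Bool) (M.accept v)) hS')
      exact Function.update_self (β := fun k => List (Alph M k)) (.inr ()) _ S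
  | succ n ih =>
    obtain ⟨⟨c', l₁⟩, hc, h⟩ := h
    rw [Nat.succ_mul] at hB
    by_cases hq : q = M.ask
    · subst hq
      cases l with
      | nil => cases (M.listStep_nil (c := ⟨some M.ask, v, R⟩) rfl).symm.trans hc
      | cons b l =>
        obtain ⟨rfl, rfl⟩ := Prod.mk.inj (Option.some.inj
          ((M.listStep_cons (c := ⟨some M.ask, v, R⟩) rfl b l).symm.trans hc))
        have hl' : l <:+ a := (List.suffix_cons b l).trans hl
        have e₁ : TM2.step (prog M a) ⟨some (.inl M.ask), (v, ⟨b :: l, hl⟩, y), S⟩ =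
            some ⟨some (.inr b), (v, ⟨l, hl'⟩, b), S⟩ := by
          simp only [TM2.step, prog_ask]
          rfl
        obtain ⟨⟨v₂, r₂, y₂⟩, S₂, p₂, a₂, b₂, h₂⟩ := reach_drain
          (st := TM2.step (prog M a)) (emb := id)
          (l := .inr b) (ret := .inl (if b then M.yes else M.no)) (a := .inl M.tm.k₁)
          (fun k _ => ([] : List (Alph M k))) (fun s => s.1 = v ∧ s.2.1 = ⟨l, hl'⟩)
          (by
            intro s S x r hs hx
            refine ⟨(s.1, s.2.1, true), Function.update S (.inl M.tm.k₁) r, hs,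
              Function.update_self _ _ _, fun k hk => Function.update_of_ne hk _ _, ?_⟩
            simp only [TM2.step, prog, TM2.stepAux, id, hx]
            rfl)
          (by
            intro s S hs hx
            refine ⟨(s.1, s.2.1, false), hs, ?_⟩
            simp only [TM2.step, prog, TM2.stepAux, id, hx]
            refine congrArg (fun S => some (TM2.Cfg.mk _ _ S)) ?_
            exact (congrArg (Function.update S _) hx.symm).trans (Function.update_eq_self _ _))
          (v, ⟨l, hl'⟩, b) S ⟨rfl, rfl⟩
        obtain ⟨rfl, rfl⟩ := p₂
        have b₃ : ∀ k, k ≠ .inl M.tm.k₁ → S₂ k = S k := fun k hk => by rw [b₂ k hk]; simp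
        obtain ⟨e, i₁, i₂, i₃, i₄⟩ := ih h (by simp; omega) hl' y₂ S₂
          (fun k => by
            by_cases hk : k = M.tm.k₁
            · subst hk
              exact a₂.trans (Function.update_self (β := fun k => List (M.tm.Γ k)) _ _ _).symm
            · refine (b₃ _ (by simpa using hk)).trans ((hS k).trans ?_)
              exact (Function.update_of_ne hk _ _).symm)
          ((b₃ _ (by simp)).trans hS')
        refine ⟨e, ((Reach.head e₁ h₂).trans i₁).mono ?_, i₂, i₃, i₄⟩
        have : (S (.inl M.tm.k₁)).length = (R M.tm.k₁).length := congrArg _ (hS _)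
        rw [Nat.succ_mul]
        omega
    · rw [M.listStep_of_ne (c := ⟨some q, v, R⟩) (fun h => hq (Option.some.inj h))] at hc
      cases hc
      have hlen := length_stepAux_le (M.tm.m q) v R M.tm.k₁
      have := hC q
      obtain ⟨c, hc⟩ : ∃ c, c = TM2.stepAux (M.tm.m q) v R := ⟨_, rfl⟩
      replace h : Steps M.listStep n (c, l) (d, l') := by rw [hc]; exact h
      rw [← hc] at hlen
      obtain ⟨S', h₁, h₂, e₁⟩ : ∃ S' : ∀ k, List (Alph M k), (∀ k, S' (.inl k) = c.stk k) ∧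
          S' (.inr ()) = S (.inr ()) ∧
          ∀ o, c.l = o → TM2.step (prog M a) ⟨some (.inl q), (v, ⟨l, hl⟩, y), S⟩ =
            some (match o with
            | some l' => ⟨some (.inl l'), (c.var, ⟨l, hl⟩, y), S'⟩
            | none => TM2.stepAux (.push (.inr ()) (fun s => M.accept s.1) .halt)
              (c.var, ⟨l, hl⟩, y) S') := by
        obtain ⟨S', h₁, h₂, h₃⟩ := stepAux_liftStmt (Γ' := Alph M) Sum.inl_injective isLens_fst
          Sum.inl (.push (.inr ()) (fun s => M.accept s.1) .halt) (M.tm.m q)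
          ((v, ⟨l, hl⟩, y) : State M a) S v rfl R hS
        subst hc
        refine ⟨S', h₁, h₂ _ (by simp), fun o ho => congrArg some ?_⟩
        rw [prog_of_ne hq]
        refine h₃.trans ?_
        have ho : (TM2.stepAux (Γ := fun k => Alph M (.inl k)) (M.tm.m q) v R).l = o := ho
        rw [ho]
        cases o <;> rfl
      clear hc
      have hr : S' (.inr ()) = [] := h₂.trans hS'
      obtain ⟨cl, cv, cS⟩ := c
      cases cl with
      | none =>
        have hdc : d = ⟨none, cv, cS⟩ := by
          cases n with
          | zero => cases h; rfl
          | succ n =>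
            obtain ⟨_, h, _⟩ := h
            cases (M.listStep_halted (c := ⟨none, cv, cS⟩) rfl l).symm.trans h
        subst hdc
        refine ⟨_, (Reach.one (e₁ _ rfl)).mono (by omega), rfl, fun k => ?_, ?_⟩
        · refine Eq.trans ?_ (h₁ k)
          exact Function.update_of_ne (β := fun k => List (Alph M k))
            (Sum.inl_ne_inr : .inl k ≠ Sum.inr ()) (M.accept cv :: S' (.inr ())) S'
        · refine Eq.trans ?_ (congrArg (List.cons (α := Bool) (M.accept cv)) hr)
          exact Function.update_self (β := fun k => List (Alph M k)) (.inr ()) _ S'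
      | some q' =>
        obtain ⟨e, i₁, i₂, i₃, i₄⟩ := ih h (by dsimp only at hlen ⊢; omega) hl y S' h₁ hr
        refine ⟨e, (Reach.head (e₁ _ rfl) i₁).mono ?_, i₂, i₃, i₄⟩
        rw [Nat.succ_mul]
        omega

end Simulation

namespace Simulation

variable (M : OracleTM) (a : List Bool)

theorem finite_suffixes : Finite {l : List Bool // l <:+ a} :=
  ((List.finite_toSet a.tails).subset fun _ h => (List.mem_tails _ _).2 h).to_subtype

/-- The simulation with an arbitrary output stack. -/
noncomputable def machine (k : M.tm.K ⊕ Unit) : FinTM2 :=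
  let := M.tm.kFin
  let := M.tm.ΛFin
  let := M.tm.σFin
  let := finite_suffixes a
  let := Fintype.ofFinite {l : List Bool // l <:+ a}
  { K := M.tm.K ⊕ Unit
    k₀ := .inl M.tm.k₀
    k₁ := k
    Γ := Alph M
    Λ := Lab M
    main := .inl M.tm.main
    σ := State M a
    initialState := (M.tm.initialState, ⟨a, List.suffix_rfl⟩, false)
    Γk₀Fin := M.tm.Γk₀Fin
    m := prog M a }

variable {M a}

/-- For fixed answers, one program yields both the verdict and the next query; the two machines
differ only in the stack declared as output. -/
theorem fp_final {p : ℕ[X]} {e : Word → M.tm.Cfg}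
    (he : ∀ x : Word, ∃ n ≤ p.eval x.length, ∃ l, Steps M.listStep n (M.init x, a) (e x, l) ∧
      ((e x).l = none ∨ ((e x).l = some M.ask ∧ l = []))) :
    Dec (id : Word → Word) (fun x => M.accept (e x).var) ∧
      FP (id : Word → Word) fun x => M.query (e x) := by
  let := M.tm.ΛFin
  obtain ⟨C₀, hC⟩ := exists_growth_bound M.tm.m
  have key : ∀ x : Word, ∃ d : TM2.Cfg (Alph M) (Lab M) (State M a),
      Reach (TM2.step (prog M a)) ⟨some (.inl M.tm.main),
        (M.tm.initialState, ⟨a, List.suffix_rfl⟩, false),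
        Function.update (fun _ => []) (.inl M.tm.k₀) (x.map M.inputAlphabet.symm)⟩ d
        (p.eval x.length * (x.length + p.eval x.length * C₀ + 2) + 1) ∧
      d.l = none ∧ (∀ k, d.stk (.inl k) = (e x).stk k) ∧
      d.stk (.inr ()) = [M.accept (e x).var] := by
    intro x
    obtain ⟨n, hn, l, h, hd⟩ := he x
    rw [OracleTM.init, initList_eq] at h
    obtain ⟨d, h₁, h₂⟩ := reach_simulation hC h hd (B := x.length + p.eval x.length * C₀)
      (Nat.add_le_add ((length_startStk_le _ _ _ _).trans (by simp)) (Nat.mul_le_mul_right _ hn))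
      List.suffix_rfl false
      (Function.update (fun _ => []) (.inl M.tm.k₀) (x.map M.inputAlphabet.symm))
      (startStk_comp (Γ' := Alph M) Sum.inl_injective _ _)
      (Function.update_of_ne (by simp) _ _)
    exact ⟨d, h₁.mono (Nat.add_le_add_right (Nat.mul_le_mul_right _ hn) _), h₂⟩
  have ht : PolyBdd fun n => p.eval n * (n + p.eval n * C₀ + 2) + 1 :=
    .add (.mul (.poly p) (.add (.add .id (.mul (.poly p) (.const _))) (.const _))) (.const _)
  constructor
  · refine ⟨⟨machine M a (.inr ()), M.inputAlphabet, Equiv.refl Bool⟩, _, ht, fun x => ?_⟩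
    obtain ⟨d, h₁, h₂, -, h₄⟩ := key x
    exact ⟨d, h₁, h₂, (List.map_id _).trans h₄⟩
  · refine ⟨⟨machine M a (.inl M.tm.k₁), M.inputAlphabet, M.outputAlphabet⟩, _, ht, fun x => ?_⟩
    obtain ⟨d, h₁, h₂, h₃, -⟩ := key x
    exact ⟨d, h₁, h₂, congrArg (List.map M.outputAlphabet) (h₃ _)⟩

end Simulation

/-! ### Prescribed answers and trees of oracles. -/

/-- The tree of oracles of the shape `T` which give the answers `a`. -/
def answerTree : List Bool → BinaryTree ℕ+ → BinaryTree (Language Bool)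
  | _, .nil => .nil
  | a, .node _ l r =>
    .node ({_w | a.head? = some true} : Set Word) (answerTree a.tail l) (answerTree a.tail r)

theorem treeRel_answerTree (a : List Bool) (T : BinaryTree ℕ+) :
    TreeRel (fun _ _ => True) T (answerTree a T) := by
  induction T generalizing a with
  | nil => exact .nil
  | node n l r ihl ihr => exact .node trivial (ihl _) (ihr _)

/-- The subtree that is reached by the answers `a`. -/
def descend {α : Type} : List Bool → BinaryTree α → BinaryTree α
  | [], T => T
  | b :: a, T => descend a (if b then T.right else T.left)

theorem descend_append {α : Type} (a : List Bool) (b : Bool) (T : BinaryTree α) :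
    descend (a ++ [b]) T = if b then (descend a T).right else (descend a T).left := by
  induction a generalizing T with
  | nil => rfl
  | cons _ a ih => exact ih _

/-- The answers `a`, followed by a tree of oracles. -/
def answersThen : List Bool → BinaryTree (Language Bool) → BinaryTree (Language Bool)
  | [], O => O
  | b :: a, O => .node ({_w | b = true} : Set Word) (answersThen a O) (answersThen a O)

/-- A last prescribed answer can be read as a root with a constant oracle. Prescribing one more
answer thus changes only the tree that follows `a`. -/
theorem answersThen_append (a : List Bool) (b : Bool) (O : BinaryTree (Language Bool)) :
    answersThen (a ++ [b]) O = answersThen a (.node ({_w | b = true} : Set Word) O O) := by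
  induction a with
  | nil => rfl
  | cons _ a ih => simp only [List.cons_append, answersThen, ih]

theorem Steps.cancel {Z : Type*} {f : Z → Option Z} {n k : ℕ} {a b c : Z} (h : Steps f n a b)
    (h' : Steps f k a c) (hc : f c = none) : ∃ k', Steps f k' b c := by
  induction n generalizing a k with
  | zero => cases h; exact ⟨k, h'⟩
  | succ n ih =>
    obtain ⟨d, hd, h⟩ := h
    cases k with
    | zero => cases h'; simp [hc] at hd
    | succ k =>
      obtain ⟨e, he, h'⟩ := h'
      rw [hd] at he
      cases he
      exact ih h h'

namespace OracleTM

variable {M : OracleTM}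

/-- The two runs agree until the answers are exhausted. A query made then must find an internal node
of `T`, since at a leaf the machine would be stuck and could not reach the halted configuration `d`.
-/
theorem exists_final {n : ℕ} {c d : M.tm.Cfg} {a : List Bool} {T : BinaryTree ℕ+}
    {O : BinaryTree (Language Bool)} (h : Steps M.step n (c, answerTree a T) (d, O))
    (hd : d.l = none) : ∃ k ≤ n, ∃ e l, Steps M.listStep k (c, a) (e, l) ∧
      (e.l = none ∨ (e.l = some M.ask ∧ l = [] ∧ descend a T ≠ .nil)) := by
  induction n generalizing c a T with
  | zero => cases h; exact ⟨0, le_rfl, d, a, rfl, .inl hd⟩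
  | succ n ih =>
    obtain ⟨z, hz, h⟩ := h
    by_cases hc : c.l = some M.ask
    · cases T with
      | nil => cases (M.step_nil hc).symm.trans hz
      | node m l r =>
        match a with
        | [] => exact ⟨0, Nat.zero_le _, c, [], rfl, .inr ⟨hc, rfl, by nofun⟩⟩
        | false :: a =>
          cases (M.step_no hc (A := ({_w | (false :: a).head? = some true} : Set Word))
            (fun h : some false = some true => by cases h) _ _).symm.trans hz
          obtain ⟨k, hk, e, l', h, he⟩ := ih h
          exact ⟨k + 1, by omega, e, l', ⟨_, M.listStep_cons hc _ _, h⟩, he⟩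
        | true :: a =>
          cases (M.step_yes hc (A := ({_w | (true :: a).head? = some true} : Set Word))
            (rfl : some true = some true) _ _).symm.trans hz
          obtain ⟨k, hk, e, l', h, he⟩ := ih h
          exact ⟨k + 1, by omega, e, l', ⟨_, M.listStep_cons hc _ _, h⟩, he⟩
    · rw [M.step_of_ne hc] at hz
      cases hs : M.tm.step c with
      | none => rw [hs] at hz; cases hz
      | some c' =>
        rw [hs] at hz
        cases hz
        obtain ⟨k, hk, e, l', h, he⟩ := ih h
        exact ⟨k + 1, by omega, e, l', ⟨_, (M.listStep_of_ne hc a).trans (by rw [hs]; rfl), h⟩, he⟩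

theorem steps_answersThen {n : ℕ} {c d : M.tm.Cfg} {a a' : List Bool}
    (h : Steps M.listStep n (c, a) (d, a')) (O : BinaryTree (Language Bool)) :
    Steps M.step n (c, answersThen a O) (d, answersThen a' O) := by
  induction n generalizing c a with
  | zero => cases h; rfl
  | succ n ih =>
    obtain ⟨⟨c', a₁⟩, hc', h⟩ := h
    refine ⟨(c', answersThen a₁ O), ?_, ih h⟩
    by_cases hc : c.l = some M.ask
    · match a with
      | [] => cases (M.listStep_nil hc).symm.trans hc'
      | false :: a =>
        cases (M.listStep_cons hc _ _).symm.trans hc'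
        exact M.step_no hc (fun h : false = true => by cases h) _ _
      | true :: a =>
        cases (M.listStep_cons hc _ _).symm.trans hc'
        exact M.step_yes hc (rfl : true = true) _ _
    · rw [M.listStep_of_ne hc] at hc'
      rw [M.step_of_ne hc]
      cases hs : M.tm.step c with
      | none => rw [hs] at hc'; cases hc'
      | some c' =>
        rw [hs] at hc'
        cases hc'
        rfl

/-- The machine `M` halts on input `x` with the oracles `O`, and accepts. -/
def Accepts (M : OracleTM) (O : BinaryTree (Language Bool)) (x : Word) : Prop :=
  ∃ n c O', Steps M.step n (M.init x, O) (c, O') ∧ c.l = none ∧ M.accept c.var = true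

theorem HaltsWith.accepts_iff {O : BinaryTree (Language Bool)} {x : Word} {t : ℕ} {b : Bool}
    (h : M.HaltsWith O x t b) : M.Accepts O x ↔ M.HaltsWith O x t true := by
  constructor
  · rintro ⟨n, c, O', h', hc, ha⟩
    have := HaltsWith.unique (t' := n) h ⟨c, O', reach_iff.1 ⟨n, le_rfl, h'⟩, hc, ha⟩
    rwa [← this]
  · rintro ⟨c, O', h, hc, ha⟩
    obtain ⟨n, -, h⟩ := reach_iff.2 h
    exact ⟨n, c, O', h, hc, ha⟩

theorem accepts_iff_of_halted {n : ℕ} {e : M.tm.Cfg} {a l : List Bool} {x : Word}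
    (h : Steps M.listStep n (M.init x, a) (e, l)) (he : e.l = none)
    (O : BinaryTree (Language Bool)) :
    M.Accepts (answersThen a O) x ↔ M.accept e.var = true := by
  have h := steps_answersThen h O
  constructor
  · rintro ⟨n', c, O', h', hc, ha⟩
    have := h.unique (M.step_halted he _) h' (M.step_halted hc _)
    rwa [(Prod.mk.inj this).1]
  · exact fun ha => ⟨n, e, _, h, he, ha⟩

/-- The answers `a` lead to the pending query at `e` whatever tree follows. If the next step from
there is the same for two trees, so is the rest of the run. -/
theorem accepts_of_step_eq {n : ℕ} {e : M.tm.Cfg} {a : List Bool} {x : Word}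
    (h : Steps M.listStep n (M.init x, a) (e, [])) (he : e.l = some M.ask)
    {O O' : BinaryTree (Language Bool)} (hO : M.step (e, O) = M.step (e, O'))
    (hacc : M.Accepts (answersThen a O) x) : M.Accepts (answersThen a O') x := by
  obtain ⟨k, c, O'', hk, hc, ha⟩ := hacc
  obtain ⟨k', hk'⟩ := (steps_answersThen h O).cancel hk (M.step_halted hc _)
  cases k' with
  | zero =>
    cases hk'
    rw [he] at hc
    cases hc
  | succ k' =>
    obtain ⟨z, hz, hk'⟩ := hk'
    exact ⟨_, c, O'', (steps_answersThen h O').trans (k := k' + 1)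
      ⟨z, hO.symm.trans hz, hk'⟩, hc, ha⟩

theorem accepts_iff_of_step_eq {n : ℕ} {e : M.tm.Cfg} {a : List Bool} {x : Word}
    (h : Steps M.listStep n (M.init x, a) (e, [])) (he : e.l = some M.ask)
    {O O' : BinaryTree (Language Bool)} (hO : M.step (e, O) = M.step (e, O')) :
    M.Accepts (answersThen a O) x ↔ M.Accepts (answersThen a O') x :=
  ⟨accepts_of_step_eq h he hO, accepts_of_step_eq h he hO.symm⟩

-- Induction on the tree of oracles below the node reached by `a`. The next query is a
-- polynomial-time function of `x`, so the oracle at the node contributes its level of the hierarchy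
-- as the number of changes, and `Rep.ite` joins the two subtrees.
open Classical in
theorem exists_rep_accepts {T : BinaryTree ℕ+}
    (hM : ∀ a : List Bool, ∃ e : Word → M.tm.Cfg,
      Dec (id : Word → Word) (fun x => M.accept (e x).var) ∧
      FP (id : Word → Word) (fun x => M.query (e x)) ∧
      ∀ x, ∃ n l, Steps M.listStep n (M.init x, a) (e x, l) ∧
        ((e x).l = none ∨ ((e x).l = some M.ask ∧ l = [] ∧ descend a T ≠ .nil)))
    {T' : BinaryTree ℕ+} {O : BinaryTree (Language Bool)}
    (hO : TreeRel (fun (n : ℕ+) A => A ∈ BH n) T' O) (a : List Bool) (ha : descend a T = T') :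
    ∃ b, Rep b (mindChanges T') fun x => decide (M.Accepts (answersThen a O) x) := by
  induction hO generalizing a with
  | nil =>
    obtain ⟨e, hacc, -, he⟩ := hM a
    refine ⟨fun x => M.accept (e x).var, ?_⟩
    have hF : (fun x => decide (M.Accepts (answersThen a .nil) x)) =
        fun x => M.accept (e x).var := by
      funext x
      obtain ⟨n, l, h, hl⟩ := he x
      -- At a leaf no query can be pending, so the machine has halted.
      have hl := hl.resolve_right fun h => h.2.2 ha
      rw [Bool.eq_iff_iff, decide_eq_true_eq, accepts_iff_of_halted h hl]
    rw [hF]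
    exact Rep.of_dec hacc
  | @node n A l r O O' hA _ _ ihl ihr =>
    obtain ⟨e, -, hq, he⟩ := hM a
    obtain ⟨n, hn⟩ := n
    obtain ⟨k, rfl⟩ : ∃ k, n = k + 1 := ⟨n - 1, by omega⟩
    obtain ⟨b, hb⟩ := ihl (a ++ [false]) (by rw [descend_append, ha]; rfl)
    obtain ⟨c, hc⟩ := ihr (a ++ [true]) (by rw [descend_append, ha]; rfl)
    refine ⟨b, ?_⟩
    have := Rep.ite (M := mindChanges (.node ⟨k + 1, hn⟩ l r)) (rep_of_mem_BH hA hq) hb hc (by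
      -- For even `k + 1` and odd `mindChanges r`, the full sum would force `i₀ = k + 1` and `i₁ =
      -- mindChanges l`; then `hpar` gives `j` the parity of `mindChanges l`, which is not that of
      -- the sum.
      intro i₀ i₁ i₂ j h₀ h₁ h₂ hj hpar
      simp only [bodd_eq_bodd_iff, bodd_eq_false_iff] at hpar
      simp only [mindChanges, Nat.even_iff, Nat.odd_iff, PNat.mk_coe]
      split_ifs <;> omega)
    convert this using 2 with x
    obtain ⟨i, l', h, hl | ⟨hl, rfl, -⟩⟩ := he x
    -- If the machine halts without a further query, both branches give the same verdict.
    · simp only [answersThen_append, accepts_iff_of_halted h hl, ite_self]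
    · by_cases hx : M.query (e x) ∈ A
      · rw [if_pos (decide_eq_true hx), answersThen_append, decide_eq_decide]
        exact accepts_iff_of_step_eq h hl ((M.step_yes hl hx _ _).trans
          (M.step_yes hl (A := ({_w | true = true} : Set Word)) (rfl : true = true) _ _).symm)
      · rw [if_neg (by simpa using hx), answersThen_append, decide_eq_decide]
        exact accepts_iff_of_step_eq h hl ((M.step_no hl hx _ _).trans
          (M.step_no hl (A := ({_w | false = true} : Set Word)) (fun h => by cases h) _ _).symm)

end OracleTM

/-! ### The two inclusions. -/

theorem exists_rep_of_mem_PTree {T : BinaryTree ℕ+} {L : Language Bool} (h : L ∈ PTree T) :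
    ∃ b, Rep b (mindChanges T) fun x => open Classical in decide (x ∈ L) := by
  classical
  obtain ⟨M, p, hM, O, hO, hL⟩ := h
  have key : ∀ (a : List Bool) (x : Word), ∃ e : M.tm.Cfg, ∃ n ≤ p.eval x.length, ∃ l,
      Steps M.listStep n (M.init x, a) (e, l) ∧
        (e.l = none ∨ (e.l = some M.ask ∧ l = [] ∧ descend a T ≠ .nil)) := by
    intro a x
    -- Halting for arbitrary oracles is essential here: the answers `a` need not be those of the
    -- actual oracles.
    obtain ⟨_, c, O', h, hc, -⟩ := hM _ (treeRel_answerTree a T) x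
    obtain ⟨n, hn, h⟩ := reach_iff.2 h
    obtain ⟨k, hk, e, l, h⟩ := OracleTM.exists_final h hc
    exact ⟨e, k, hk.trans hn, l, h⟩
  choose e he using key
  obtain ⟨b, hb⟩ := OracleTM.exists_rep_accepts (T := T) (fun a => by
    have := Simulation.fp_final (a := a) (e := e a) fun x => by
      obtain ⟨n, hn, l, h, h'⟩ := he a x
      exact ⟨n, hn, l, h, h'.imp_right fun h => ⟨h.1, h.2.1⟩⟩
    refine ⟨e a, this.1, this.2, fun x => ?_⟩
    obtain ⟨n, -, l, h⟩ := he a x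
    exact ⟨n, l, h⟩) hO [] rfl
  refine ⟨b, ?_⟩
  convert hb using 2 with x
  rw [decide_eq_decide, hL]
  obtain ⟨_, h⟩ := hM O (hO.mono fun _ _ _ => trivial) x
  exact h.accepts_iff.symm

theorem PTree_eq_ttClosure (T : BinaryTree ℕ+) : PTree T = ttClosure (mindChanges T) NP := by
  classical
  ext L
  constructor
  · intro h
    obtain ⟨b, h⟩ := exists_rep_of_mem_PTree h
    obtain ⟨hb, N, hN, hle, h⟩ := h.exists_npNumber
    exact mem_ttClosure_of_npNumber hb hN hle fun x => by rw [← h, decide_eq_true_eq]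
  · intro h
    obtain ⟨b, h⟩ := exists_rep_of_mem_ttClosure h
    obtain ⟨hb, N, hN, hle, h⟩ := h.exists_npNumber
    exact mem_PTree_of_npNumber hb hN hle fun x => by rw [← h, decide_eq_true_eq]

end QueryOrder

theorem theorem4p3 (T : BinaryTree ℕ+) :
    QueryOrder.PTree T = QueryOrder.ttClosure (QueryOrder.mindChanges T) QueryOrder.NP :=
  QueryOrder.PTree_eq_ttClosure T
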